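/- Let $N\ge 1$, $K=\lfloor N/2\rfloor$, let $|m_1|,\dots,|m_N|$ be distinct positive numbers, let $\zeta_1,\dots,\zeta_K$ be distinct complex numbers, none of which lies on the negative real axis $(-\infty,0)$, and let $b_1,\dots,b_K,c\in\mathbb C$, where $c=0$ if $N$ is even. Put $$W(z)=c+\sum_{j=1}^{K}\frac{b_j}{\zeta_j-z}.$$ **Inverse problem.** Find $g_j,h_j\in\mathbb C$ ($1\le j\le N$) with $g_jh_j=|m_j|^2$ for all $j$, such that the polynomials $q_k,p_k$ in $z$ determined by $$q_k-q_{k-1}=h_kp_{k-1},\qquad p_k-p_{k-1}=-z\,g_kq_{k-1}\quad(1\le k\le N),\qquad q_0=0,\ p_0=1,$$ satisfy $W=q_N/p_N$ as rational functions of $z$. **Notation.** Let $j'=N-j+1$, $[1,k]=\{1,\dots,k\}$, $\mathbf e=(e_1,\dots,e_N)$ with $e_j=1/|m_{j'}|^2$. For a vector $\mathbf x$ and index sets $I,J$ let $\mathbf x_J=\prod_{j\in J}x_j$, $\Delta_J(\mathbf x)=\prod_{i<j;\ i,j\in J}(x_j-x_i)$ and $\Gamma_{I,J}(\mathbf x;\mathbf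 y)=\prod_{i\in I}\prod_{j\in J}(x_i+y_j)$, empty products being $1$. Let $$S_k^{(r,p)}=\sum_{J\subseteq\{1,\dots,K\},\ |J|=r}\frac{\Delta_J(\zeta)^2\,(\zeta_J)^p\,\mathbf b_J}{\Gamma_{[1,k],J}(\mathbf e;\zeta)}$$ (so $S_k^{(r,p)}=0$ for $r>K$ and for $r=-1$), and $$\mathcal D_k^{(l,p)}=\begin{cases}\Delta_{[1,k]}(\mathbf e)\,S_k^{(l,p)}, & \text{if } c=0 \text{ or } p+l-1<k-l,\\ \Delta_{[1,k]}(\mathbf e)\,\bigl(S_k^{(l,p)}+c\,S_k^{(l-1,p)}\bigr), & \text{if } c\ne0 \text{ and } p+l-1=k-l.\end{cases}$$ In particular $\mathcal D_0^{(0,p)}=1$ for $p\in\{0,1\}$. **Theorem.** Suppose that for every $1\le k\le N$ the following quantities are nonzero: $\mathcal D_k^{(\frac{k+1}2,0)}$ and $\mathcal D_k^{(\frac{k-1}2,1)}$ if $k$ is odd; $\mathcal D_k^{(\frac k2,0)}$ and $\mathcal D_k^{(\frac k2,1)}$ if $k$ is even. Then the inverse problem has a unique solution $(g_j,h_j)_{1\le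 j\le N}$. It is given, for $1\le k\le N$, by $$g_{k'}=\frac{\mathcal D_k^{(\frac{k-1}{2},1)}\mathcal D_{k-1}^{(\frac{k-1}{2},1)}}{\mathbf e_{[1,k]}\mathcal D_k^{(\frac{k+1}{2},0)}\mathcal D_{k-1}^{(\frac{k-1}{2},0)}},\qquad h_{k'}=\frac{\mathbf e_{[1,k-1]}\mathcal D_k^{(\frac{k+1}{2},0)}\mathcal D_{k-1}^{(\frac{k-1}{2},0)}}{\mathcal D_k^{(\frac{k-1}{2},1)}\mathcal D_{k-1}^{(\frac{k-1}{2},1)}}\qquad(k\text{ odd}),$$ $$g_{k'}=\frac{\mathcal D_k^{(\frac k2,1)}\mathcal D_{k-1}^{(\frac k2-1,1)}}{\mathbf e_{[1,k]}\mathcal D_k^{(\frac k2,0)}\mathcal D_{k-1}^{(\frac k2,0)}},\qquad h_{k'}=\frac{\mathbf e_{[1,k-1]}\mathcal D_k^{(\frac k2,0)}\mathcal D_{k-1}^{(\frac k2,0)}}{\mathcal D_k^{(\frac k2,1)}\mathcal D_{k-1}^{(\frac k2-1,1)}}\qquad(k\text{ even}).$$ -/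

import Mathlib

/-!
Indices are shifted by one: the `j`-th object of the mathematical text (`1 ≤ j ≤ N`) is the one at
position `j - 1` in `Fin N`. In particular `j' = N - j + 1` becomes `Fin.rev`.
-/

namespace PeakonInverse

open Polynomial

/-- `q, p` solve the initial value problem `q_k - q_{k-1} = h_k p_{k-1}`,
`p_k - p_{k-1} = -z g_k q_{k-1}` for `1 ≤ k ≤ N`, with `q_0 = 0`, `p_0 = 1`;
all the `q_k, p_k` are polynomials in `z`. -/
structure SolvesIVP {N : ℕ} (g h : Fin N → ℂ) (q p : Fin (N + 1) → ℂ[X]) : Prop where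
  q_zero : q 0 = 0
  p_zero : p 0 = 1
  q_step : ∀ k : Fin N, q k.succ - q k.castSucc = C (h k) * p k.castSucc
  p_step : ∀ k : Fin N, p k.succ - p k.castSucc = -(X * C (g k) * q k.castSucc)

/-- The rational function `W(z) = c + ∑_{j=1}^K b_j / (ζ_j - z)`. -/
noncomputable def weyl {K : ℕ} (c : ℂ) (b ζ : Fin K → ℂ) : RatFunc ℂ :=
  RatFunc.C c + ∑ j, RatFunc.C (b j) / (RatFunc.C (ζ j) - RatFunc.X)

/-- `(g, h)` solves the inverse problem with data `W` and `m_1, …, m_N` (standing for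
`|m_1|, …, |m_N|`): `g_j h_j = |m_j|^2`, and the solution of the initial value problem satisfies
`q_N / p_N = W`, as rational functions of `z`. -/
def SolvesInverseProblem {N : ℕ} (W : RatFunc ℂ) (m : Fin N → ℝ) (g h : Fin N → ℂ) : Prop :=
  (∀ j, g j * h j = (m j : ℂ) ^ 2) ∧
  ∃ q p : Fin (N + 1) → ℂ[X], SolvesIVP g h q p ∧
    algebraMap ℂ[X] (RatFunc ℂ) (q (Fin.last N)) / algebraMap ℂ[X] (RatFunc ℂ) (p (Fin.last N)) = W

/-- `e_j = 1 / |m_{j'}|^2`. -/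
noncomputable def eVec {N : ℕ} (m : Fin N → ℝ) (j : Fin N) : ℂ := 1 / (m j.rev : ℂ) ^ 2

/-- The index set `[1, k]`, as a subset of the indices of a vector of length `N`. -/
def initSeg (N k : ℕ) : Finset (Fin N) := Finset.univ.filter fun i => i.val < k

/-- `x_J = ∏_{j ∈ J} x_j`. -/
noncomputable def prodOver {n : ℕ} (x : Fin n → ℂ) (J : Finset (Fin n)) : ℂ := ∏ j ∈ J, x j

/-- `Δ_J(x) = ∏_{i < j ∈ J} (x_j - x_i)`. -/
noncomputable def vdm {n : ℕ} (x : Fin n → ℂ) (J : Finset (Fin n)) : ℂ :=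
  ∏ j ∈ J, ∏ i ∈ J.filter (fun i => i < j), (x j - x i)

/-- `Γ_{I,J}(x; y) = ∏_{i ∈ I} ∏_{j ∈ J} (x_i + y_j)`. -/
noncomputable def cauchyProd {n n' : ℕ} (x : Fin n → ℂ) (y : Fin n' → ℂ)
    (I : Finset (Fin n)) (J : Finset (Fin n')) : ℂ :=
  ∏ i ∈ I, ∏ j ∈ J, (x i + y j)

/-- `Δ_J(ζ)^2 (ζ_J)^p b_J / Γ_{[1,k],J}(e; ζ)`. -/
noncomputable def summand {N K : ℕ} (e : Fin N → ℂ) (b ζ : Fin K → ℂ) (k p : ℕ)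
    (J : Finset (Fin K)) : ℂ :=
  vdm ζ J ^ 2 * prodOver ζ J ^ p * prodOver b J / cauchyProd e ζ (initSeg N k) J

/-- The quantity `D_k^{(l,p)}`. The two sums run over the index sets `J` of size `l` and of size
`l - 1` respectively; there is no index set of size `-1`. If `c ≠ 0` and `p + l - 1 > k - l`, then
`D_k^{(l,p)}` is not defined in the text, and gets the value `0` here. -/
noncomputable def D {N K : ℕ} (e : Fin N → ℂ) (c : ℂ) (b ζ : Fin K → ℂ) (k l p : ℕ) : ℂ :=
  open Classical in
  if c = 0 ∨ (p : ℤ) + l - 1 < (k : ℤ) - l then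
    vdm e (initSeg N k) *
      ∑ J ∈ Finset.univ.filter (fun J : Finset (Fin K) => J.card = l), summand e b ζ k p J
  else if (p : ℤ) + l - 1 = (k : ℤ) - l then
    vdm e (initSeg N k) *
      (∑ J ∈ Finset.univ.filter (fun J : Finset (Fin K) => J.card = l), summand e b ζ k p J +
        c * ∑ J ∈ Finset.univ.filter (fun J : Finset (Fin K) => J.card + 1 = l),
          summand e b ζ k p J)
  else 0

end PeakonInverse

/-! The step matrix `[[1, h], [-z g, 1]]` has determinant `1 + z g h`. When `g h = 1/e`, it is
singular exactly at `z = -e`, and there `q = h p` after the step. Hence `h_{k'}` is the value at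
`-e_k` of `Q'/P'`, the quotient left after the last `k - 1` steps have been undone, and `g_{k'}`
follows from the product `g h`.

Undoing `k` steps gives `α Q - β P = M Q'` and `z γ Q + δ P = M P'` with `M = ∏ (1 + z/e_i)`, degree
bounds of about `k/2`, and `α(0) = δ(0) = 1` (`Peeled`). As `M` vanishes at the nodes `-e_i`, both
`α W - β` and `z γ W + δ` vanish there: a multipoint Padé problem. What remains is to evaluate these
two functions at the next node.

For this, each function is multiplied by a test polynomial `∏_{j ∈ J} (ζ_j - z)` and its divided
difference over all `k + 1` nodes is taken. Only the new node contributes on one side; partial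
fractions of `W` give a sum over the poles `ζ_s` on the other (`numerator_functional`,
`denominator_functional`). Weighting by `Δ_J(ζ)^2 w_J` and summing over `J` of fixed size turns this
into ratios of subset sums, i.e. of the `D_k^{(l,p)}` (`subsetSum_numerator_identity`,
`subsetSum_denominator_identity`). `Peeled.eval_at_neg` combines the two evaluations.

Uniqueness: any solution is peeled down, and its strengths are forced. Existence: peeling `W` with
the formulas always leaves polynomials, and the degrees fall until `Q = 0`, `P = 1`
(`exists_chain`). -/

namespace PeakonInverse

open Polynomial

/-! ### Weighted subset sums and the test polynomials `∏ (ζ_j - X)`. -/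

/-- `∑_{|J| = l} Δ_J(ζ)^2 w_J`. -/
noncomputable def subsetSum {n : ℕ} (ζ w : Fin n → ℂ) (l : ℕ) : ℂ :=
  ∑ J ∈ Finset.univ.filter (fun J : Finset (Fin n) => J.card = l), vdm ζ J ^ 2 * prodOver w J

/-- `∑_{|J| = l - 1} Δ_J(ζ)^2 w_J`, which is `0` for `l = 0`. -/
noncomputable def subsetSumPred {n : ℕ} (ζ w : Fin n → ℂ) (l : ℕ) : ℂ :=
  ∑ J ∈ Finset.univ.filter (fun J : Finset (Fin n) => J.card + 1 = l), vdm ζ J ^ 2 * prodOver w J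

/-- `∏_{j ∈ J} (ζ_j - X)`. -/
noncomputable def revNodal {n : ℕ} (ζ : Fin n → ℂ) (J : Finset (Fin n)) : ℂ[X] :=
  ∏ j ∈ J, (C (ζ j) - X)

lemma subsetSumPred_zero {n : ℕ} (ζ w : Fin n → ℂ) : subsetSumPred ζ w 0 = 0 := by
  simp [subsetSumPred]

lemma subsetSumPred_succ {n : ℕ} (ζ w : Fin n → ℂ) (l : ℕ) :
    subsetSumPred ζ w (l + 1) = subsetSum ζ w l := by
  simp [subsetSumPred, subsetSum]

lemma subsetSum_zero {n : ℕ} (ζ w : Fin n → ℂ) : subsetSum ζ w 0 = 1 := by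
  simp only [subsetSum, Finset.card_eq_zero]
  rw [Finset.filter_eq']
  simp [vdm, prodOver]

lemma eval_revNodal {n : ℕ} (ζ : Fin n → ℂ) (J : Finset (Fin n)) (z : ℂ) :
    (revNodal ζ J).eval z = ∏ j ∈ J, (ζ j - z) := by
  simp [revNodal, eval_prod]

lemma natDegree_revNodal_le {n : ℕ} (ζ : Fin n → ℂ) (J : Finset (Fin n)) :
    (revNodal ζ J).natDegree ≤ J.card := by
  refine (natDegree_prod_le _ _).trans ?_
  rw [Finset.card_eq_sum_ones]
  refine Finset.sum_le_sum fun j _ => ?_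
  compute_degree

lemma coeff_card_revNodal {n : ℕ} (ζ : Fin n → ℂ) (J : Finset (Fin n)) :
    (revNodal ζ J).coeff J.card = (-1) ^ J.card := by
  have h := coeff_prod_of_natDegree_le (s := J) (f := fun j => C (ζ j) - X) (n := 1)
    (fun j _ => by compute_degree)
  rw [mul_one] at h
  rw [revNodal, h, ← Finset.prod_const]
  refine Finset.prod_congr rfl fun j _ => ?_
  simp

lemma coeff_mul_revNodal {n : ℕ} (ζ : Fin n → ℂ) (J : Finset (Fin n)) {f : ℂ[X]} {d : ℕ}
    (hf : f.natDegree ≤ d) :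
    (f * revNodal ζ J).coeff (d + J.card) = f.coeff d * (-1) ^ J.card := by
  rw [coeff_mul_add_eq_of_natDegree_le hf (natDegree_revNodal_le ζ J), coeff_card_revNodal]

lemma natDegree_mul_revNodal_le {n : ℕ} (ζ : Fin n → ℂ) (J : Finset (Fin n)) {f : ℂ[X]} {d : ℕ}
    (hf : f.natDegree ≤ d) : (f * revNodal ζ J).natDegree ≤ d + J.card :=
  natDegree_mul_le_of_le hf (natDegree_revNodal_le ζ J)

/-- Squaring removes the sign that depends on the position of `s` in the order. -/
lemma vdm_insert_sq {n : ℕ} (ζ : Fin n → ℂ) {J : Finset (Fin n)} {s : Fin n} (hs : s ∉ J) :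
    vdm ζ (insert s J) ^ 2 = vdm ζ J ^ 2 * (∏ j ∈ J, (ζ j - ζ s)) ^ 2 := by
  have h1 : vdm ζ (insert s J) = (∏ i ∈ J.filter (fun i => i < s), (ζ s - ζ i)) *
      (vdm ζ J * ∏ j ∈ J.filter (fun j => ¬ j < s), (ζ j - ζ s)) := by
    rw [vdm, Finset.prod_insert hs, Finset.filter_insert, if_neg (lt_irrefl s), vdm,
      Finset.prod_filter (fun j => ¬ j < s), ← Finset.prod_mul_distrib]
    congr 1
    refine Finset.prod_congr rfl fun j hj => ?_
    have hne : j ≠ s := fun h => hs (h ▸ hj)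
    rw [Finset.filter_insert]
    by_cases hlt : j < s
    · simp [hlt, hlt.not_gt]
    · have : s < j := lt_of_le_of_ne (not_lt.mp hlt) hne.symm
      rw [if_pos this, if_pos hlt, Finset.prod_insert (by simp [hs]), mul_comm]
  have h2 : (∏ i ∈ J.filter (fun i => i < s), (ζ s - ζ i)) ^ 2 =
      (∏ i ∈ J.filter (fun i => i < s), (ζ i - ζ s)) ^ 2 := by
    rw [← Finset.prod_pow, ← Finset.prod_pow]
    exact Finset.prod_congr rfl fun i _ => by ring
  rw [h1, ← Finset.prod_filter_mul_prod_filter_not J (fun i => i < s), mul_pow, mul_pow, mul_pow, h2]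
  ring

lemma vdm_ne_zero {n : ℕ} {x : Fin n → ℂ} (hx : Function.Injective x) (J : Finset (Fin n)) :
    vdm x J ≠ 0 := by
  refine Finset.prod_ne_zero_iff.mpr fun j _ => Finset.prod_ne_zero_iff.mpr fun i hi => ?_
  rw [sub_ne_zero]
  exact fun h => (Finset.mem_filter.mp hi).2.ne' (hx h)

/-- Reindexing by `(J, s) ↦ (J ∪ {s}, s)`; the pairs with `s ∈ J` contribute nothing. -/
lemma sum_card_eq_sum_card_succ {n : ℕ} (l : ℕ) (u : Finset (Fin n) → Fin n → ℂ)
    (hu : ∀ J, ∀ s ∈ J, u J s = 0) :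
    ∑ J ∈ Finset.univ.filter (fun J : Finset (Fin n) => J.card = l), ∑ s, u J s =
      ∑ J ∈ Finset.univ.filter (fun J : Finset (Fin n) => J.card = l + 1),
        ∑ s ∈ J, u (J.erase s) s := by
  have h : ∀ J : Finset (Fin n), ∑ s, u J s = ∑ s ∈ Jᶜ, u J s := fun J => by
    refine (Finset.sum_subset (Finset.subset_univ _) fun s _ hs => hu J s ?_).symm
    simpa using hs
  simp_rw [h]
  rw [Finset.sum_sigma', Finset.sum_sigma']
  refine Finset.sum_bij' (fun a _ => ⟨insert a.2 a.1, a.2⟩) (fun a _ => ⟨a.1.erase a.2, a.2⟩)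
    ?_ ?_ ?_ ?_ ?_
  · rintro ⟨J, s⟩ ha
    simp only [Finset.mem_sigma, Finset.mem_filter, Finset.mem_univ, true_and,
      Finset.mem_compl] at ha ⊢
    exact ⟨by rw [Finset.card_insert_of_notMem ha.2, ha.1], Finset.mem_insert_self _ _⟩
  · rintro ⟨J, s⟩ ha
    simp only [Finset.mem_sigma, Finset.mem_filter, Finset.mem_univ, true_and,
      Finset.mem_compl] at ha ⊢
    exact ⟨by rw [Finset.card_erase_of_mem ha.2, ha.1]; rfl, Finset.notMem_erase _ _⟩
  · rintro ⟨J, s⟩ ha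
    simp only [Finset.mem_sigma, Finset.mem_compl] at ha
    simp [Finset.erase_insert ha.2]
  · rintro ⟨J, s⟩ ha
    simp only [Finset.mem_sigma] at ha
    simp [Finset.insert_erase ha.2]
  · rintro ⟨J, s⟩ ha
    simp only [Finset.mem_sigma, Finset.mem_compl] at ha
    simp [Finset.erase_insert ha.2]

/-- Adjoining `s` multiplies `Δ^2` by the square of the product over `J.erase s`, while the left
side supplies only its first power. The missing factor becomes the denominator of a Lagrange
coefficient. -/
lemma vdm_sq_mul_prodOver_erase {n : ℕ} {ζ : Fin n → ℂ} (hζ : Function.Injective ζ)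
    (w : Fin n → ℂ) {J : Finset (Fin n)} {s : Fin n} (hs : s ∈ J) (a : ℂ) :
    vdm ζ (J.erase s) ^ 2 * prodOver w (J.erase s) *
      (w s * a * ∏ j ∈ J.erase s, (ζ j - ζ s)) =
      vdm ζ J ^ 2 * prodOver w J * (a / ∏ j ∈ J.erase s, (ζ j - ζ s)) := by
  have h0 : ∏ j ∈ J.erase s, (ζ j - ζ s) ≠ 0 := Finset.prod_ne_zero_iff.mpr fun j hj =>
    sub_ne_zero.mpr fun h => (Finset.mem_erase.mp hj).1 (hζ h)
  have h1 := vdm_insert_sq ζ (Finset.notMem_erase s J)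
  rw [Finset.insert_erase hs] at h1
  have h2 : prodOver w J = w s * prodOver w (J.erase s) := (Finset.mul_prod_erase _ _ hs).symm
  rw [h1, h2]
  field_simp

lemma prod_sub_comm_eq {ι : Type*} (J : Finset ι) (x : ι → ℂ) (z : ℂ) :
    ∏ j ∈ J, (x j - z) = (-1) ^ J.card * ∏ j ∈ J, (z - x j) := by
  rw [← Finset.prod_const, ← Finset.prod_mul_distrib]
  exact Finset.prod_congr rfl fun j _ => by ring

lemma prod_erase_sub_ne_zero {ι : Type*} [DecidableEq ι] {x : ι → ℂ}
    (hx : Function.Injective x) (I : Finset ι) (i : ι) :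
    ∏ j ∈ I.erase i, (x i - x j) ≠ 0 :=
  Finset.prod_ne_zero_iff.mpr fun _ hj =>
    sub_ne_zero.mpr fun h => (Finset.mem_erase.mp hj).1 (hx h).symm

/-! ### Subset sums evaluated by Lagrange interpolation. -/

/-- The Hankel-type sum against a polynomial of degree at most `l`. -/
lemma sum_vdm_sq_mul_sum_eval {n : ℕ} {ζ : Fin n → ℂ} (hζ : Function.Injective ζ)
    (w : Fin n → ℂ) {l : ℕ} {f : ℂ[X]} (hf : f.natDegree ≤ l) :
    ∑ J ∈ Finset.univ.filter (fun J : Finset (Fin n) => J.card = l),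
      vdm ζ J ^ 2 * prodOver w J * ∑ s, w s * (f * revNodal ζ J).eval (ζ s) =
      (-1) ^ l * f.coeff l * subsetSum ζ w (l + 1) := by
  simp_rw [Finset.mul_sum]
  rw [sum_card_eq_sum_card_succ, subsetSum, Finset.mul_sum]
  · refine Finset.sum_congr rfl fun J hJ => ?_
    have hJ : J.card = l + 1 := (Finset.mem_filter.mp hJ).2
    have h1 : ∀ s ∈ J, vdm ζ (J.erase s) ^ 2 * prodOver w (J.erase s) *
        (w s * (f * revNodal ζ (J.erase s)).eval (ζ s)) =
        vdm ζ J ^ 2 * prodOver w J *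
          ((-1) ^ l * (f.eval (ζ s) / ∏ j ∈ J.erase s, (ζ s - ζ j))) := fun s hs => by
      rw [eval_mul, eval_revNodal, ← mul_assoc (w s), vdm_sq_mul_prodOver_erase hζ w hs,
        prod_sub_comm_eq, Finset.card_erase_of_mem hs, hJ, Nat.add_sub_cancel]
      congr 1
      rw [div_mul_eq_div_div_swap, div_eq_mul_inv _ ((-1 : ℂ) ^ l), ← inv_pow, inv_neg_one,
        mul_comm]
    rw [Finset.sum_congr rfl h1, ← Finset.mul_sum, ← Finset.mul_sum]
    -- For fixed `J` of size `l + 1`, the sum over `s` is the divided difference of `f` over the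
    -- `ζ_s`, so it only sees the coefficient of degree `l`.
    have h2 := Lagrange.coeff_eq_sum (s := J) (v := ζ) hζ.injOn (P := f) (by
      rw [hJ]
      exact (degree_le_of_natDegree_le hf).trans_lt (by exact_mod_cast Nat.lt_succ_self l))
    rw [hJ, Nat.add_sub_cancel] at h2
    rw [← h2]
    ring
  · intro J s hs
    rw [eval_mul, eval_revNodal, Finset.prod_eq_zero hs (sub_self _)]
    ring

lemma eval_eq_sum_div_mul_prod {ι : Type*} [DecidableEq ι] {x : ι → ℂ}
    (hx : Function.Injective x) {I : Finset ι} {p : ℂ[X]} (hp : p.degree < I.card) (z : ℂ) :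
    p.eval z = ∑ i ∈ I, p.eval (x i) / (∏ j ∈ I.erase i, (x i - x j)) *
      ∏ j ∈ I.erase i, (z - x j) := by
  have h := Lagrange.eq_interpolate (hx.injOn (s := (I : Set ι))) hp
  rw [Lagrange.interpolate_eq_sum] at h
  nth_rewrite 1 [h]
  simp [eval_finsetSum, eval_prod]

/-- The Hankel-type sum against the constant polynomial `1`, with shifted weights. -/
lemma sum_vdm_sq_mul_sum_one {n : ℕ} {ζ : Fin n → ℂ} (hζ : Function.Injective ζ)
    (w : Fin n → ℂ) (l : ℕ) :
    ∑ J ∈ Finset.univ.filter (fun J : Finset (Fin n) => J.card = l),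
      vdm ζ J ^ 2 * prodOver (fun s => w s * ζ s) J * ∑ s, w s * (revNodal ζ J).eval (ζ s) =
      subsetSum ζ w (l + 1) := by
  simp_rw [Finset.mul_sum]
  rw [sum_card_eq_sum_card_succ, subsetSum]
  · refine Finset.sum_congr rfl fun J hJ => ?_
    have hJ : J.card = l + 1 := (Finset.mem_filter.mp hJ).2
    have h1 : ∀ s ∈ J, vdm ζ (J.erase s) ^ 2 * prodOver (fun s => w s * ζ s) (J.erase s) *
        (w s * (revNodal ζ (J.erase s)).eval (ζ s)) =
        vdm ζ J ^ 2 * prodOver w J * ((1 : ℂ[X]).eval (ζ s) / (∏ j ∈ J.erase s, (ζ s - ζ j)) *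
          ∏ j ∈ J.erase s, (0 - ζ j)) := fun s hs => by
      have h2 : prodOver (fun s => w s * ζ s) (J.erase s) =
          prodOver w (J.erase s) * prodOver ζ (J.erase s) := Finset.prod_mul_distrib
      have h3 := prod_sub_comm_eq (J.erase s) ζ 0
      have h4 := vdm_sq_mul_prodOver_erase hζ w hs (prodOver ζ (J.erase s))
      have h5 : ((-1 : ℂ) ^ (J.erase s).card) ^ 2 = 1 := by
        rw [← pow_mul, mul_comm, pow_mul]; simp
      have h6 := prod_erase_sub_ne_zero hζ J s
      simp only [sub_zero] at h3
      rw [prod_sub_comm_eq] at h4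
      rw [eval_revNodal, h2, prod_sub_comm_eq, eval_one]
      have h7 : prodOver ζ (J.erase s) = _ := h3
      calc _ = _ := by ring
        _ = _ := h4
        _ = _ := by
          rw [h7]
          have h8 : (-1 : ℂ) ^ (J.erase s).card ≠ 0 := pow_ne_zero _ (by simp)
          field_simp
    rw [Finset.sum_congr rfl h1, ← Finset.mul_sum]
    -- The sum over `s` is the value at `0` of the interpolant of the constant `1`.
    have h2 := eval_eq_sum_div_mul_prod hζ (I := J) (p := 1) (by
      rw [hJ, degree_one]; exact_mod_cast Nat.succ_pos l) 0
    rw [← h2, eval_one, mul_one]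
  · intro J s hs
    rw [eval_revNodal, Finset.prod_eq_zero hs (sub_self _)]
    ring

lemma sum_filter_card_prodOver_mul {n : ℕ} {ζ : Fin n → ℂ} {v w : Fin n → ℂ} {y : ℂ}
    (hv : ∀ s, v s = w s * (ζ s - y)) (l : ℕ) :
    ∑ J ∈ Finset.univ.filter (fun J : Finset (Fin n) => J.card = l),
      vdm ζ J ^ 2 * prodOver w J * (revNodal ζ J).eval y = subsetSum ζ v l := by
  refine Finset.sum_congr rfl fun J _ => ?_
  rw [eval_revNodal, mul_assoc, prodOver, prodOver, ← Finset.prod_mul_distrib]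
  simp_rw [hv]

/-- Split `f = f(0) + X * divX f`; the factor `X` is absorbed into the weights, and the two pieces
are the two preceding sums. -/
lemma sum_vdm_sq_mul_sum_eval_mul {n : ℕ} {ζ : Fin n → ℂ} (hζ : Function.Injective ζ)
    (w : Fin n → ℂ) {l : ℕ} {f : ℂ[X]} (hf : f.natDegree ≤ l + 1) :
    ∑ J ∈ Finset.univ.filter (fun J : Finset (Fin n) => J.card = l),
      vdm ζ J ^ 2 * prodOver (fun s => w s * ζ s) J *
        ∑ s, w s * (f * revNodal ζ J).eval (ζ s) =
      f.coeff 0 * subsetSum ζ w (l + 1) +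
        (-1) ^ l * f.coeff (l + 1) * subsetSum ζ (fun s => w s * ζ s) (l + 1) := by
  have hd : f.divX.natDegree ≤ l := by rw [natDegree_divX_eq_natDegree_tsub_one]; omega
  have h1 := sum_vdm_sq_mul_sum_eval hζ (fun s => w s * ζ s) hd
  rw [coeff_divX] at h1
  rw [← h1, ← sum_vdm_sq_mul_sum_one hζ w l, Finset.mul_sum, ← Finset.sum_add_distrib]
  refine Finset.sum_congr rfl fun J _ => ?_
  rw [Finset.mul_sum, Finset.mul_sum, Finset.mul_sum, Finset.mul_sum, ← Finset.sum_add_distrib]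
  refine Finset.sum_congr rfl fun s _ => ?_
  conv_lhs => rw [← divX_mul_X_add f]
  simp only [eval_mul, eval_add, eval_X, eval_C]
  ring

/-- Summing `H` against `Δ_J^2 (wζ)_J` replaces `w` by `v` on the right. The top coefficient of `α`
is unknown; it enters only through the `c`-term, when `2 * r = k`. -/
lemma subsetSum_numerator_identity {n : ℕ} {ζ : Fin n → ℂ} (hζ : Function.Injective ζ)
    {v w : Fin n → ℂ} {α : ℂ[X]} {r k : ℕ} {c ρ y : ℂ} (hv : ∀ s, v s = w s * (ζ s - y))
    (hα : α.natDegree ≤ r) (hrk : 2 * r ≤ k)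
    (H : ∀ J : Finset (Fin n), J.card ≤ r →
      ∑ s, w s * (α * revNodal ζ J).eval (ζ s) + c * (α * revNodal ζ J).coeff k =
        ρ * (revNodal ζ J).eval y) :
    ρ * (subsetSum ζ (fun s => v s * ζ s) r +
        (if 2 * r = k then c else 0) * subsetSumPred ζ (fun s => v s * ζ s) r) =
      α.coeff 0 * (subsetSum ζ w (r + 1) +
        (if 2 * r = k then c else 0) * subsetSumPred ζ w (r + 1)) := by
  have key : ∀ l, l ≤ r → ρ * subsetSum ζ (fun s => v s * ζ s) l =
      ∑ J ∈ Finset.univ.filter (fun J : Finset (Fin n) => J.card = l),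
        vdm ζ J ^ 2 * prodOver (fun s => w s * ζ s) J *
          (∑ s, w s * (α * revNodal ζ J).eval (ζ s) + c * (α * revNodal ζ J).coeff k) := by
    intro l hl
    rw [← sum_filter_card_prodOver_mul (w := fun s => w s * ζ s) (y := y)
      (v := fun s => v s * ζ s) (fun s => by simp only [hv]; ring),
      Finset.mul_sum]
    refine Finset.sum_congr rfl fun J hJ => ?_
    rw [H J (by rw [(Finset.mem_filter.mp hJ).2]; exact hl)]
    ring
  have key1 : ρ * subsetSum ζ (fun s => v s * ζ s) r = α.coeff 0 * subsetSum ζ w (r + 1) +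
      (if 2 * r = k then c else 0) * ((-1) ^ r * α.coeff r) *
        subsetSum ζ (fun s => w s * ζ s) r := by
    rw [key r le_rfl]
    simp_rw [mul_add]
    rw [Finset.sum_add_distrib, sum_vdm_sq_mul_sum_eval_mul hζ w (hα.trans (Nat.le_succ r)),
      coeff_eq_zero_of_natDegree_lt (Nat.lt_succ_of_le hα), mul_zero, zero_mul, add_zero]
    congr 1
    rw [subsetSum, Finset.mul_sum]
    refine Finset.sum_congr rfl fun J hJ => ?_
    have hJ := (Finset.mem_filter.mp hJ).2
    split_ifs with h
    · have := coeff_mul_revNodal ζ J hα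
      rw [hJ, ← two_mul, h] at this
      rw [this]
      ring
    · rw [coeff_eq_zero_of_natDegree_lt
        ((natDegree_mul_revNodal_le ζ J hα).trans_lt (by omega))]
      ring
  split_ifs with h
  · rw [if_pos h] at key1
    rcases r with _ | r
    · simp only [subsetSumPred_zero, subsetSumPred_succ, subsetSum_zero] at key1 ⊢
      linear_combination key1
    -- Index sets one element smaller are too small for the `c`-term, but give a second relation
    -- containing the top coefficient of `α`. Adding `c` times it eliminates that coefficient.
    · have key2 := key r (by omega)
      have h2 : ∀ J ∈ Finset.univ.filter (fun J : Finset (Fin n) => J.card = r),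
          vdm ζ J ^ 2 * prodOver (fun s => w s * ζ s) J *
            (∑ s, w s * (α * revNodal ζ J).eval (ζ s) + c * (α * revNodal ζ J).coeff k) =
          vdm ζ J ^ 2 * prodOver (fun s => w s * ζ s) J *
            (∑ s, w s * (α * revNodal ζ J).eval (ζ s)) := fun J hJ => by
        have hJ := (Finset.mem_filter.mp hJ).2
        rw [coeff_eq_zero_of_natDegree_lt
          ((natDegree_mul_revNodal_le ζ J hα).trans_lt (by omega)), mul_zero, add_zero]
      rw [Finset.sum_congr rfl h2, sum_vdm_sq_mul_sum_eval_mul hζ w hα] at key2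
      rw [subsetSumPred_succ, subsetSumPred_succ]
      linear_combination key1 + c * key2
  · rw [if_neg h] at key1
    rw [zero_mul, zero_mul, add_zero, add_zero, key1]
    ring

/-- As for the numerator, but with weights `w`: the value at `y` turns `w` into `v`, and the value
at `0` turns it into `wζ`. -/
lemma subsetSum_denominator_identity {n : ℕ} {ζ : Fin n → ℂ} (hζ : Function.Injective ζ)
    {v w : Fin n → ℂ} {γ : ℂ[X]} {l k : ℕ} {c ρ y ε : ℂ} (hv : ∀ s, v s = w s * (ζ s - y))
    (hγ : γ.degree < l) (hlk : 2 * l ≤ k + 1)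
    (H : ∀ J : Finset (Fin n), J.card ≤ l →
      y * (∑ s, w s * (γ * revNodal ζ J).eval (ζ s) + c * (γ * revNodal ζ J).coeff k) =
        ρ * (revNodal ζ J).eval y - (revNodal ζ J).eval 0 * ε) :
    ρ * (subsetSum ζ v l + (if 2 * l = k + 1 then c else 0) * subsetSumPred ζ v l) =
      ε * (subsetSum ζ (fun s => w s * ζ s) l +
        (if 2 * l = k + 1 then c else 0) * subsetSumPred ζ (fun s => w s * ζ s) l) := by
  have key : ∀ j, j ≤ l → ρ * subsetSum ζ v j - ε * subsetSum ζ (fun s => w s * ζ s) j =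
      y * ∑ J ∈ Finset.univ.filter (fun J : Finset (Fin n) => J.card = j),
        vdm ζ J ^ 2 * prodOver w J *
          (∑ s, w s * (γ * revNodal ζ J).eval (ζ s) + c * (γ * revNodal ζ J).coeff k) := by
    intro j hj
    rw [← sum_filter_card_prodOver_mul hv,
      ← sum_filter_card_prodOver_mul (w := w) (y := 0) (v := fun s => w s * ζ s) (ζ := ζ)
      (fun s => by ring), Finset.mul_sum, Finset.mul_sum, Finset.mul_sum,
      ← Finset.sum_sub_distrib]
    refine Finset.sum_congr rfl fun J hJ => ?_
    rw [mul_left_comm y, H J (by rw [(Finset.mem_filter.mp hJ).2]; exact hj)]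
    ring
  rcases l with _ | l
  · have hγ0 : γ = 0 := by simpa using hγ
    have h := key 0 le_rfl
    simp only [hγ0, zero_mul, eval_zero, coeff_zero, mul_zero, Finset.sum_const_zero, add_zero,
      subsetSum_zero] at h
    rw [subsetSumPred_zero, subsetSumPred_zero, subsetSum_zero, subsetSum_zero]
    linear_combination h
  have hγ' : γ.natDegree ≤ l := by
    rcases eq_or_ne γ 0 with rfl | h0
    · simp
    · exact Nat.lt_succ_iff.mp ((natDegree_lt_iff_degree_lt h0).mpr hγ)
  have key1 : ρ * subsetSum ζ v (l + 1) - ε * subsetSum ζ (fun s => w s * ζ s) (l + 1) =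
      y * ((if 2 * (l + 1) = k + 1 then c else 0) * ((-1) ^ (l + 1) * γ.coeff l) *
        subsetSum ζ w (l + 1)) := by
    rw [key _ le_rfl]
    simp_rw [mul_add (vdm _ _ ^ 2 * _)]
    rw [Finset.sum_add_distrib, sum_vdm_sq_mul_sum_eval hζ w (hγ'.trans (Nat.le_succ l)),
      coeff_eq_zero_of_natDegree_lt (Nat.lt_succ_of_le hγ'), mul_zero, zero_mul, zero_add]
    congr 1
    rw [subsetSum, Finset.mul_sum]
    refine Finset.sum_congr rfl fun J hJ => ?_
    have hJ := (Finset.mem_filter.mp hJ).2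
    split_ifs with h
    · have := coeff_mul_revNodal ζ J hγ'
      rw [hJ, show l + (l + 1) = k by omega] at this
      rw [this]
      ring
    · rw [coeff_eq_zero_of_natDegree_lt
        ((natDegree_mul_revNodal_le ζ J hγ').trans_lt (by omega))]
      ring
  split_ifs with h
  · rw [if_pos h] at key1
    -- The smaller index sets again serve to eliminate the top coefficient, here that of `γ`.
    have key2 := key l (Nat.le_succ l)
    have h2 : ∀ J ∈ Finset.univ.filter (fun J : Finset (Fin n) => J.card = l),
        vdm ζ J ^ 2 * prodOver w J *
          (∑ s, w s * (γ * revNodal ζ J).eval (ζ s) + c * (γ * revNodal ζ J).coeff k) =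
        vdm ζ J ^ 2 * prodOver w J *
          (∑ s, w s * (γ * revNodal ζ J).eval (ζ s)) := fun J hJ => by
      have hJ := (Finset.mem_filter.mp hJ).2
      rw [coeff_eq_zero_of_natDegree_lt
        ((natDegree_mul_revNodal_le ζ J hγ').trans_lt (by omega)), mul_zero, add_zero]
    rw [Finset.sum_congr rfl h2, sum_vdm_sq_mul_sum_eval hζ w hγ'] at key2
    rw [subsetSumPred_succ, subsetSumPred_succ]
    linear_combination key1 + c * key2
  · rw [if_neg h] at key1
    linear_combination key1

/-! ### Divided differences of multiples of `W` at the nodes. -/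

lemma sum_div_prod_erase_div_sub {ι : Type*} [DecidableEq ι] {x : ι → ℂ}
    (hx : Function.Injective x) {I : Finset ι} {p : ℂ[X]} (hp : p.degree < I.card) {z : ℂ}
    (hz : ∀ i ∈ I, z - x i ≠ 0) :
    ∑ i ∈ I, p.eval (x i) / (∏ j ∈ I.erase i, (x i - x j)) / (z - x i) =
      p.eval z / ∏ i ∈ I, (z - x i) := by
  rw [eval_eq_sum_div_mul_prod hx hp z, Finset.sum_div]
  refine Finset.sum_congr rfl fun i hi => ?_
  have h1 : ∏ j ∈ I.erase i, (z - x j) ≠ 0 := Finset.prod_ne_zero_iff.mpr fun j hj =>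
    hz j (Finset.mem_of_mem_erase hj)
  rw [← Finset.mul_prod_erase I (fun j => z - x j) hi, mul_comm (z - x i), ← div_div,
    mul_div_cancel_right₀ _ h1]

/-- The values of `W`. -/
noncomputable def weylEval {K : ℕ} (c : ℂ) (b ζ : Fin K → ℂ) (z : ℂ) : ℂ :=
  c + ∑ j, b j / (ζ j - z)

/-- The divided difference of `p W`. -/
lemma sum_eval_mul_weylEval_div {ι : Type*} [DecidableEq ι] {K : ℕ} {x : ι → ℂ}
    (hx : Function.Injective x) {I : Finset ι} (c : ℂ) (b : Fin K → ℂ) {ζ : Fin K → ℂ}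
    (hζx : ∀ s, ∀ i, ζ s - x i ≠ 0) {p : ℂ[X]} (hp : p.degree < I.card) :
    ∑ i ∈ I, p.eval (x i) * weylEval c b ζ (x i) / (∏ j ∈ I.erase i, (x i - x j)) =
      ∑ s, b s / (∏ i ∈ I, (ζ s - x i)) * p.eval (ζ s) + c * p.coeff (I.card - 1) := by
  have h1 : ∀ s, b s / (∏ i ∈ I, (ζ s - x i)) * p.eval (ζ s) =
      ∑ i ∈ I, b s * (p.eval (x i) / (∏ j ∈ I.erase i, (x i - x j)) / (ζ s - x i)) := fun s => by
    rw [← Finset.mul_sum, sum_div_prod_erase_div_sub hx hp fun i _ => hζx s i]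
    ring
  rw [Lagrange.coeff_eq_sum hx.injOn hp, Finset.sum_congr rfl fun s _ => h1 s,
    Finset.sum_comm, Finset.mul_sum, ← Finset.sum_add_distrib]
  refine Finset.sum_congr rfl fun i _ => ?_
  rw [weylEval, mul_add, Finset.mul_sum, add_div, Finset.sum_div, add_comm]
  congr 1
  · exact Finset.sum_congr rfl fun s _ => by ring
  · ring

lemma degree_mul_revNodal_lt {n : ℕ} (ζ : Fin n → ℂ) (J : Finset (Fin n)) {f : ℂ[X]} {d k : ℕ}
    (hf : f.degree < d) (hk : d + J.card ≤ k) : (f * revNodal ζ J).degree < k := by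
  rcases eq_or_ne f 0 with rfl | h0
  · simp
  · have h1 := (natDegree_lt_iff_degree_lt h0).mpr hf
    have h2 := natDegree_mul_revNodal_le ζ J (le_refl f.natDegree)
    exact (degree_le_of_natDegree_le h2).trans_lt (by exact_mod_cast (by omega))

section Interpolation

variable {ι : Type*} [DecidableEq ι] {K : ℕ} {x : ι → ℂ} {I : Finset ι} {t : ι} {c : ℂ}
  {b ζ : Fin K → ℂ}

/-- Both sides are the divided difference of `(α W - β) φ` over `I ∪ {t}`, where `φ = revNodal ζ J`.
It vanishes at the nodes in `I`, and `β φ` has degree below `I.card`, so it drops out. -/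
lemma numerator_functional (hx : Function.Injective x) (ht : t ∉ I)
    (hζx : ∀ s, ∀ i, ζ s - x i ≠ 0) {α β : ℂ[X]} (hα : α.natDegree ≤ I.card / 2)
    (hβ : β.degree < ((I.card + 1) / 2 : ℕ))
    (hI : ∀ i ∈ I, α.eval (x i) * weylEval c b ζ (x i) - β.eval (x i) = 0)
    {J : Finset (Fin K)} (hJ : J.card ≤ I.card / 2) :
    ∑ s, b s / (∏ i ∈ insert t I, (ζ s - x i)) * (α * revNodal ζ J).eval (ζ s) +
        c * (α * revNodal ζ J).coeff I.card =
      (α.eval (x t) * weylEval c b ζ (x t) - β.eval (x t)) / (∏ i ∈ I, (x t - x i)) *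
        (revNodal ζ J).eval (x t) := by
  have hcard : (insert t I).card = I.card + 1 := Finset.card_insert_of_notMem ht
  have hp : (α * revNodal ζ J).degree < (insert t I).card := by
    rw [hcard]
    exact (degree_le_of_natDegree_le (natDegree_mul_revNodal_le ζ J hα)).trans_lt
      (by exact_mod_cast (by omega))
  have hq : (β * revNodal ζ J).degree < I.card := degree_mul_revNodal_lt ζ J hβ (by omega)
  have h1 := sum_eval_mul_weylEval_div hx c b hζx hp
  have h2 := Lagrange.coeff_eq_sum (s := insert t I) hx.injOn
    (hq.trans (by rw [hcard]; exact_mod_cast Nat.lt_succ_self _))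
  rw [hcard, Nat.add_sub_cancel] at h1 h2
  rw [coeff_eq_zero_of_degree_lt hq] at h2
  rw [← h1, ← sub_zero (Finset.sum _ _), h2, ← Finset.sum_sub_distrib, Finset.sum_insert ht,
    Finset.sum_eq_zero, Finset.erase_insert ht]
  · rw [eval_mul, eval_mul]
    ring
  · intro i hi
    rw [eval_mul, eval_mul]
    linear_combination (eval (x i) (revNodal ζ J) /
      ∏ j ∈ (insert t I).erase i, (x i - x j)) * hI i hi

/-- Take the divided difference of `γ W φ = (x γ W + δ) φ / x - δ φ / x`, with `φ = revNodal ζ J`.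
The first term survives only at `t`. -/
lemma denominator_functional (hx : Function.Injective x) (ht : t ∉ I) (hx0 : ∀ i, x i ≠ 0)
    (hζx : ∀ s, ∀ i, ζ s - x i ≠ 0) {γ δ : ℂ[X]} (hγ : γ.degree < ((I.card + 1) / 2 : ℕ))
    (hδ : δ.natDegree ≤ I.card / 2) (hδ0 : δ.coeff 0 = 1)
    (hI : ∀ i ∈ I, x i * γ.eval (x i) * weylEval c b ζ (x i) + δ.eval (x i) = 0)
    {J : Finset (Fin K)} (hJ : J.card ≤ (I.card + 1) / 2) :
    x t * (∑ s, b s / (∏ i ∈ insert t I, (ζ s - x i)) * (γ * revNodal ζ J).eval (ζ s) +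
        c * (γ * revNodal ζ J).coeff I.card) =
      (x t * γ.eval (x t) * weylEval c b ζ (x t) + δ.eval (x t)) / (∏ i ∈ I, (x t - x i)) *
        (revNodal ζ J).eval (x t) - (revNodal ζ J).eval 0 * (1 / ∏ i ∈ I, -x i) := by
  have hcard : (insert t I).card = I.card + 1 := Finset.card_insert_of_notMem ht
  have hlt : (I.card : WithBot ℕ) < (insert t I).card := by
    rw [hcard]; exact_mod_cast Nat.lt_succ_self _
  have hp : (γ * revNodal ζ J).degree < (insert t I).card :=
    degree_mul_revNodal_lt ζ J hγ (by omega)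
  -- Since `δ(0) = 1`, `δ φ / x = G + φ(0) / x`, and `G` has too low a degree to contribute.
  set G := (δ * revNodal ζ J).divX with hG
  have hGd : G.degree < I.card := by
    rw [degree_lt_iff_coeff_zero]
    intro m hm
    rw [hG, coeff_divX]
    exact coeff_eq_zero_of_natDegree_lt
      ((natDegree_mul_revNodal_le ζ J hδ).trans_lt (by omega))
  have h1 := sum_eval_mul_weylEval_div hx c b hζx hp
  have h2 := Lagrange.coeff_eq_sum (s := insert t I) hx.injOn (hGd.trans hlt)
  -- The case `z = 0` yields the divided difference of `1 / x`.
  have h3 := sum_div_prod_erase_div_sub hx (I := insert t I) (p := 1) (z := 0)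
    (by rw [degree_one, hcard]; exact_mod_cast Nat.succ_pos _) (fun i _ => by simpa using hx0 i)
  rw [hcard, Nat.add_sub_cancel] at h1 h2
  rw [coeff_eq_zero_of_degree_lt hGd] at h2
  have hev : ∀ z, δ.eval z * (revNodal ζ J).eval z = G.eval z * z + (revNodal ζ J).eval 0 := by
    intro z
    rw [← eval_mul, ← divX_mul_X_add (δ * revNodal ζ J), eval_add, eval_mul, eval_X, eval_C,
      mul_coeff_zero, hδ0, one_mul, coeff_zero_eq_eval_zero]
  have h4 : ∑ i ∈ insert t I, (γ * revNodal ζ J).eval (x i) * weylEval c b ζ (x i) /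
      (∏ j ∈ (insert t I).erase i, (x i - x j)) =
      ∑ i ∈ insert t I, ((x i * γ.eval (x i) * weylEval c b ζ (x i) + δ.eval (x i)) *
        (revNodal ζ J).eval (x i) / x i / (∏ j ∈ (insert t I).erase i, (x i - x j)) -
        G.eval (x i) / (∏ j ∈ (insert t I).erase i, (x i - x j)) +
        (revNodal ζ J).eval 0 * ((1 : ℂ[X]).eval (x i) /
          (∏ j ∈ (insert t I).erase i, (x i - x j)) / (0 - x i))) := by
    refine Finset.sum_congr rfl fun i _ => ?_
    have h5 := hx0 i
    have h6 := prod_erase_sub_ne_zero hx (insert t I) i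
    rw [eval_mul, eval_one, zero_sub]
    field_simp
    linear_combination -hev (x i)
  rw [Finset.sum_add_distrib, Finset.sum_sub_distrib, ← h2, ← Finset.mul_sum, h3,
    Finset.sum_insert ht (f := fun i => (x i * γ.eval (x i) * weylEval c b ζ (x i) +
      δ.eval (x i)) * (revNodal ζ J).eval (x i) / x i /
      (∏ j ∈ (insert t I).erase i, (x i - x j))),
    Finset.sum_eq_zero (s := I) (fun i hi => by rw [hI i hi]; simp), Finset.erase_insert ht,
    Finset.prod_insert ht] at h4
  rw [← h1, h4, eval_one]
  simp only [zero_sub]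
  have h7 : ∏ i ∈ I, (x t - x i) ≠ 0 := Finset.prod_ne_zero_iff.mpr fun i hi =>
    sub_ne_zero.mpr fun h => ht (hx h ▸ hi)
  have h8 : ∏ i ∈ I, -x i ≠ 0 := Finset.prod_ne_zero_iff.mpr fun i _ => neg_ne_zero.mpr (hx0 i)
  have h9 := hx0 t
  field_simp
  ring

end Interpolation

/-! ### The quantities `D` as subset sums. -/

lemma card_initSeg {N k : ℕ} (hk : k ≤ N) : (initSeg N k).card = k := by
  rw [initSeg, Fin.card_filter_val_lt, min_eq_right hk]

lemma notMem_initSeg {N k : ℕ} (hk : k < N) : (⟨k, hk⟩ : Fin N) ∉ initSeg N k := by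
  simp [initSeg]

lemma initSeg_succ {N k : ℕ} (hk : k < N) :
    initSeg N (k + 1) = insert ⟨k, hk⟩ (initSeg N k) := by
  ext i
  simp [initSeg, Fin.ext_iff]
  omega

lemma initSeg_zero (N : ℕ) : initSeg N 0 = ∅ := by simp [initSeg]

/-- The bound `h` says `p + l - 1 ≤ k - l`, so for `c ≠ 0` the default value `0` of `D` never
occurs. -/
lemma D_eq_vdm_mul {N K : ℕ} (e : Fin N → ℂ) (c : ℂ) (b ζ : Fin K → ℂ) {k l p : ℕ}
    (h : p + 2 * l ≤ k + 1) {u : Fin K → ℂ}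
    (hu : ∀ s, u s = b s * ζ s ^ p / ∏ i ∈ initSeg N k, (e i + ζ s)) :
    D e c b ζ k l p = vdm e (initSeg N k) *
      (subsetSum ζ u l + (if p + 2 * l = k + 1 then c else 0) * subsetSumPred ζ u l) := by
  have hs : ∀ J, summand e b ζ k p J = vdm ζ J ^ 2 * prodOver u J := fun J => by
    rw [summand, cauchyProd, Finset.prod_comm, mul_assoc, mul_div_assoc]
    simp only [prodOver, hu]
    rw [Finset.prod_div_distrib, Finset.prod_mul_distrib, Finset.prod_pow, mul_comm (∏ i ∈ J, b i)]
  simp only [D, hs]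
  rw [← subsetSum, ← subsetSumPred]
  by_cases hc : c = 0
  · simp [hc]
  by_cases h1 : p + 2 * l = k + 1
  · rw [if_neg (by push Not; exact ⟨hc, by omega⟩), if_pos (by omega), if_pos h1]
  · rw [if_pos (Or.inr (by omega)), if_neg h1]
    ring

/-! ### Removing transition matrices, and the value at the next node. -/

/-- `Q', P'` arise from `Q, P` by removing the transition matrices belonging to `e_i`, `i ∈ I`. -/
def Peeled {ι : Type*} (e : ι → ℂ) (I : Finset ι) (Q P Q' P' : ℂ[X]) : Prop :=
  ∃ α β γ δ : ℂ[X], α.natDegree ≤ I.card / 2 ∧ β.degree < ((I.card + 1) / 2 : ℕ) ∧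
    γ.degree < ((I.card + 1) / 2 : ℕ) ∧ δ.natDegree ≤ I.card / 2 ∧
    α.coeff 0 = 1 ∧ δ.coeff 0 = 1 ∧
    α * Q - β * P = (∏ i ∈ I, (1 + C (e i)⁻¹ * X)) * Q' ∧
    X * γ * Q + δ * P = (∏ i ∈ I, (1 + C (e i)⁻¹ * X)) * P'

lemma peeled_empty {ι : Type*} (e : ι → ℂ) (Q P : ℂ[X]) : Peeled e ∅ Q P Q P :=
  ⟨1, 0, 0, 1, by simp, by simp, by simp, by simp, by simp, by simp, by simp, by simp⟩

lemma natDegree_le_of_degree_lt {f : ℂ[X]} {a b : ℕ} (h : f.degree < a) (hab : a ≤ b + 1) :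
    f.natDegree ≤ b := by
  rcases eq_or_ne f 0 with rfl | h0
  · simp
  · have := (natDegree_lt_iff_degree_lt h0).mpr h
    omega

lemma degree_lt_of_natDegree_le {f : ℂ[X]} {a b : ℕ} (h : f.natDegree ≤ a) (hab : a < b) :
    f.degree < b :=
  (degree_le_of_natDegree_le h).trans_lt (by exact_mod_cast hab)

/-- The matrix `[[α, -β], [Xγ, δ]]` is multiplied on the left by `[[1, -h], [X g, 1]]`, the adjugate
of a step matrix. -/
lemma Peeled.step {ι : Type*} [DecidableEq ι] {e : ι → ℂ} {I : Finset ι} {t : ι} (ht : t ∉ I)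
    {Q P Q₁ P₁ Q₂ P₂ : ℂ[X]} {g h : ℂ} (hP : Peeled e I Q P Q₁ P₁)
    (h1 : Q₁ - C h * P₁ = (1 + C (e t)⁻¹ * X) * Q₂)
    (h2 : P₁ + X * C g * Q₁ = (1 + C (e t)⁻¹ * X) * P₂) : Peeled e (insert t I) Q P Q₂ P₂ := by
  obtain ⟨α, β, γ, δ, hα, hβ, hγ, hδ, hα0, hδ0, hQ, hP⟩ := hP
  refine ⟨α - C h * (X * γ), β + C h * δ, γ + C g * α, δ - C g * (X * β), ?_, ?_, ?_, ?_, ?_, ?_,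
    ?_, ?_⟩
  all_goals try rw [Finset.card_insert_of_notMem ht]
  · have h3 : (C h * (X * γ)).natDegree ≤ (I.card + 1) / 2 := by
      rcases eq_or_ne γ 0 with rfl | h0
      · simp
      · have h4 := (natDegree_lt_iff_degree_lt h0).mpr hγ
        refine (natDegree_C_mul_le _ _).trans ?_
        rw [natDegree_X_mul h0]
        omega
    exact (natDegree_sub_le _ _).trans (max_le (hα.trans (by omega)) h3)
  · have h3 : (C h * δ).degree < ((I.card + 1 + 1) / 2 : ℕ) :=
      degree_lt_of_natDegree_le ((natDegree_C_mul_le _ _).trans hδ) (by omega)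
    exact (degree_add_le _ _).trans_lt
      (max_lt (hβ.trans_le (by exact_mod_cast (by omega))) h3)
  · have h3 : (C g * α).degree < ((I.card + 1 + 1) / 2 : ℕ) :=
      degree_lt_of_natDegree_le ((natDegree_C_mul_le _ _).trans hα) (by omega)
    exact (degree_add_le _ _).trans_lt
      (max_lt (hγ.trans_le (by exact_mod_cast (by omega))) h3)
  · have h3 : (C g * (X * β)).natDegree ≤ (I.card + 1) / 2 := by
      rcases eq_or_ne β 0 with rfl | h0
      · simp
      · have h4 := (natDegree_lt_iff_degree_lt h0).mpr hβ
        refine (natDegree_C_mul_le _ _).trans ?_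
        rw [natDegree_X_mul h0]
        omega
    exact (natDegree_sub_le _ _).trans (max_le (hδ.trans (by omega)) h3)
  · simp [hα0]
  · simp [hδ0]
  · rw [Finset.prod_insert ht]
    linear_combination hQ - C h * hP + (∏ i ∈ I, (1 + C (e i)⁻¹ * X)) * h1
  · rw [Finset.prod_insert ht]
    linear_combination hP + X * C g * hQ + (∏ i ∈ I, (1 + C (e i)⁻¹ * X)) * h2

/-- `q₁ / p₁ = R / S`, with `R` from `hnum` and `S` from `hden`. Since `b₂ ≠ 0` forces `S ≠ 0`,
neither `a₁` nor `a₂` has to be nonzero. -/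
lemma eval_quotient_aux {V₁ V₂ a₁ b₁ a₂ b₂ d E M R S p₀ p₁ q₁ : ℂ} (hV1 : V₁ ≠ 0) (hV2 : V₂ ≠ 0)
    (hb1 : b₁ ≠ 0) (hb2 : b₂ ≠ 0) (hd : d ≠ 0) (hE : E ≠ 0) (hM : M ≠ 0)
    (hp0 : p₀ ≠ 0) (hnum : R / d * b₁ = a₂) (hden : S / d * a₁ = 1 / E * b₂)
    (hR : R * p₀ = M * q₁) (hS : S * p₀ = M * p₁) :
    p₁ ≠ 0 ∧ q₁ = (E * (V₂ * a₂) * (V₁ * a₁)) / (V₂ * b₂ * (V₁ * b₁)) * p₁ := by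
  have hS0 : S ≠ 0 := by
    rintro rfl
    rw [zero_div, zero_mul] at hden
    exact mul_ne_zero (one_div_ne_zero hE) hb2 hden.symm
  have hp1 : p₁ ≠ 0 := by
    rintro rfl
    rw [mul_zero] at hS
    exact mul_ne_zero hS0 hp0 hS
  refine ⟨hp1, ?_⟩
  have hR' : R * b₁ = d * a₂ := by rw [← hnum]; field_simp
  have hS' : S * a₁ * E = d * b₂ := by
    field_simp at hden
    linear_combination hden
  have hcross : q₁ * S = R * p₁ := by
    refine mul_left_cancel₀ (mul_ne_zero hM hp0) ?_
    linear_combination -S * p₀ * hR + R * p₀ * hS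
  have hq : q₁ * (b₂ * b₁) = E * a₂ * a₁ * p₁ := by
    refine mul_left_cancel₀ (mul_ne_zero hd hS0) ?_
    linear_combination (d * b₂ * b₁) * hcross + (d * b₂ * p₁) * hR' - (d * a₂ * p₁) * hS'
  field_simp
  linear_combination hq

section Data

variable {N K : ℕ} {e : Fin N → ℂ} {c : ℂ} {b ζ : Fin K → ℂ}

/-- The value at `-e_{k+1}` of the quotient `Q' / P'` after `k` steps of peeling. -/
lemma Peeled.eval_at_neg (he : Function.Injective e) (he0 : ∀ i, e i ≠ 0)
    (hζ : Function.Injective ζ) (heζ : ∀ i s, e i + ζ s ≠ 0) {k : ℕ} (hk : k < N)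
    {Q P Q' P' : ℂ[X]} (hP0 : ∀ i, P.eval (-e i) ≠ 0)
    (hQ : ∀ i, Q.eval (-e i) = weylEval c b ζ (-e i) * P.eval (-e i))
    (hB : D e c b ζ k (k / 2) 1 ≠ 0)
    (hB' : D e c b ζ (k + 1) ((k + 1) / 2) 1 ≠ 0)
    (hP : Peeled e (initSeg N k) Q P Q' P') :
    P'.eval (-e ⟨k, hk⟩) ≠ 0 ∧ Q'.eval (-e ⟨k, hk⟩) =
      (prodOver e (initSeg N k) * D e c b ζ (k + 1) ((k + 2) / 2) 0 *
        D e c b ζ k ((k + 1) / 2) 0) / (D e c b ζ (k + 1) ((k + 1) / 2) 1 *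
        D e c b ζ k (k / 2) 1) * P'.eval (-e ⟨k, hk⟩) := by
  obtain ⟨α, β, γ, δ, hα, hβ, hγ, hδ, hα0, hδ0, hQ', hP'⟩ := hP
  have hcard := card_initSeg hk.le
  have hnot := notMem_initSeg hk
  set I := initSeg N k with hI
  set t : Fin N := ⟨k, hk⟩ with ht
  have hx : Function.Injective fun i => -e i := neg_injective.comp he
  have hx0 : ∀ i, -e i ≠ 0 := fun i => neg_ne_zero.mpr (he0 i)
  have hζx : ∀ s, ∀ i, ζ s - -e i ≠ 0 := fun s i => by
    rw [sub_neg_eq_add, add_comm]; exact heζ i s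
  -- The product of determinants vanishes at the removed nodes; with `P ≠ 0` there, this gives the
  -- interpolation conditions.
  have hM : ∀ i ∈ I, (∏ j ∈ I, (1 + C (e j)⁻¹ * X)).eval (-e i) = 0 := fun i hi => by
    rw [eval_prod]
    exact Finset.prod_eq_zero hi (by simp [he0 i])
  have hMt : (∏ j ∈ I, (1 + C (e j)⁻¹ * X)).eval (-e t) ≠ 0 := by
    rw [eval_prod]
    refine Finset.prod_ne_zero_iff.mpr fun j hj => ?_
    have h1 : e j ≠ e t := fun h => hnot (he h ▸ hj)
    have h2 := he0 j
    simp only [eval_add, eval_one, eval_mul, eval_C, eval_X]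
    field_simp
    exact div_ne_zero (sub_ne_zero.mpr h1) h2
  have hR : ∀ i, (α.eval (-e i) * weylEval c b ζ (-e i) - β.eval (-e i)) * P.eval (-e i) =
      (∏ j ∈ I, (1 + C (e j)⁻¹ * X)).eval (-e i) * Q'.eval (-e i) := fun i => by
    rw [← eval_mul, ← hQ', eval_sub, eval_mul, eval_mul, hQ]
    ring
  have hS : ∀ i, (-e i * γ.eval (-e i) * weylEval c b ζ (-e i) + δ.eval (-e i)) *
      P.eval (-e i) = (∏ j ∈ I, (1 + C (e j)⁻¹ * X)).eval (-e i) * P'.eval (-e i) := fun i => by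
    rw [← eval_mul, ← hP', eval_add, eval_mul, eval_mul, eval_mul, eval_X, hQ]
    ring
  -- `w` carries the weights of level `k + 1` and `v` those of level `k`; they differ by the factor
  -- of the new node `-e t`.
  set w : Fin K → ℂ := fun s => b s / ∏ i ∈ insert t I, (ζ s - -e i) with hw
  set v : Fin K → ℂ := fun s => b s / ∏ i ∈ I, (ζ s - -e i) with hv
  have hvw : ∀ s, v s = w s * (ζ s - -e t) := fun s => by
    have := hζx s t
    simp only [hv, hw, Finset.prod_insert hnot]
    rw [mul_comm (ζ s - -e t), ← div_div, div_mul_cancel₀ _ this]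
  have hnum := subsetSum_numerator_identity hζ (c := c) hvw hα (by omega) fun J hJ =>
    numerator_functional (c := c) (b := b) (x := fun i => -e i) hx hnot hζx hα hβ
      (fun i hi => (mul_eq_zero.mp ((hR i).trans (by rw [hM i hi, zero_mul]))).resolve_right
        (hP0 i)) hJ
  have hden := subsetSum_denominator_identity hζ (c := c) hvw hγ (by omega) fun J hJ =>
    denominator_functional (c := c) (b := b) (x := fun i => -e i) hx hnot hx0 hζx hγ hδ hδ0
      (fun i hi => (mul_eq_zero.mp ((hS i).trans (by rw [hM i hi, zero_mul]))).resolve_right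
        (hP0 i)) hJ
  simp only [hcard, hα0, one_mul, neg_neg] at hnum hden
  have hsucc : initSeg N (k + 1) = insert t I := initSeg_succ hk
  have hv' : ∀ s, v s = b s / ∏ i ∈ initSeg N k, (e i + ζ s) := fun s => by
    simp only [hv, hI, sub_neg_eq_add, add_comm]
  have hw' : ∀ s, w s = b s / ∏ i ∈ initSeg N (k + 1), (e i + ζ s) := fun s => by
    simp only [hw, hsucc, sub_neg_eq_add, add_comm]
  have hD1 : D e c b ζ k ((k + 1) / 2) 0 = vdm e I * (subsetSum ζ v ((k + 1) / 2) +
      (if 2 * ((k + 1) / 2) = k + 1 then c else 0) * subsetSumPred ζ v ((k + 1) / 2)) := by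
    rw [D_eq_vdm_mul e c b ζ (u := v) (by omega) fun s => by rw [hv', pow_zero, mul_one], zero_add]
  have hD2 : D e c b ζ k (k / 2) 1 = vdm e I * (subsetSum ζ (fun s => v s * ζ s) (k / 2) +
      (if 2 * (k / 2) = k then c else 0) * subsetSumPred ζ (fun s => v s * ζ s) (k / 2)) := by
    rw [D_eq_vdm_mul e c b ζ (u := fun s => v s * ζ s) (by omega)
      fun s => by rw [hv', pow_one, div_mul_eq_mul_div]]
    simp only [show (1 + 2 * (k / 2) = k + 1) = (2 * (k / 2) = k) from propext (by omega), hI]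
  have hD3 : D e c b ζ (k + 1) ((k + 1) / 2) 1 = vdm e (initSeg N (k + 1)) *
      (subsetSum ζ (fun s => w s * ζ s) ((k + 1) / 2) +
        (if 2 * ((k + 1) / 2) = k + 1 then c else 0) *
          subsetSumPred ζ (fun s => w s * ζ s) ((k + 1) / 2)) := by
    rw [D_eq_vdm_mul e c b ζ (u := fun s => w s * ζ s) (by omega)
      fun s => by rw [hw', pow_one, div_mul_eq_mul_div]]
    simp only [show (1 + 2 * ((k + 1) / 2) = k + 1 + 1) = (2 * ((k + 1) / 2) = k + 1) from
      propext (by omega)]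
  have hD4 : D e c b ζ (k + 1) ((k + 2) / 2) 0 = vdm e (initSeg N (k + 1)) *
      (subsetSum ζ w (k / 2 + 1) +
        (if 2 * (k / 2) = k then c else 0) * subsetSumPred ζ w (k / 2 + 1)) := by
    rw [D_eq_vdm_mul e c b ζ (u := w) (by omega) fun s => by rw [hw', pow_zero, mul_one],
      show (k + 2) / 2 = k / 2 + 1 by omega]
    simp only [show (0 + 2 * (k / 2 + 1) = k + 1 + 1) = (2 * (k / 2) = k) from
      propext (by omega)]
  rw [hD2] at hB
  rw [hD3] at hB'
  rw [hD1, hD2, hD3, hD4]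
  exact eval_quotient_aux (vdm_ne_zero he _) (vdm_ne_zero he _)
    (right_ne_zero_of_mul hB) (right_ne_zero_of_mul hB')
    (Finset.prod_ne_zero_iff.mpr fun i hi => sub_ne_zero.mpr fun h => hnot ((hx h : t = i) ▸ hi))
    (Finset.prod_ne_zero_iff.mpr fun i _ => he0 i) hMt (hP0 t) hnum hden (hR t) (hS t)

end Data

/-! ### Existence: peeling down to the initial values. -/

lemma exists_mul_of_eval_neg_eq_zero {a : ℂ} (ha : a ≠ 0) {f : ℂ[X]} (hf : f.eval (-a) = 0) :
    ∃ f', f = (1 + C a⁻¹ * X) * f' := by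
  obtain ⟨q, hq⟩ := dvd_iff_isRoot.mpr hf
  refine ⟨C a * q, ?_⟩
  have h : C a * C a⁻¹ = (1 : ℂ[X]) := by rw [← C_mul, mul_inv_cancel₀ ha, C_1]
  rw [hq, C_neg]
  linear_combination (-X * q) * h

lemma natDegree_one_add_C_mul_X_mul {a : ℂ} (ha : a ≠ 0) {f : ℂ[X]} (hf : f ≠ 0) :
    ((1 + C a * X) * f).natDegree = f.natDegree + 1 := by
  have h : (1 + C a * X).natDegree = 1 := by
    rw [add_comm, ← C_1, natDegree_linear ha]
  rw [natDegree_mul (fun h0 => by simp [h0] at h) hf, h, add_comm]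

lemma one_add_C_mul_X_ne_zero (a : ℂ) : (1 + C a * X : ℂ[X]) ≠ 0 := fun h => by
  simpa using congrArg (fun p : ℂ[X] => p.coeff 0) h

/-- Peeling off all the transition matrices leaves `Q = 0`, `P = 1`. -/
lemma exists_chain {N : ℕ} {e g h : Fin N → ℂ} {Q P : ℂ[X]} (he0 : ∀ i, e i ≠ 0)
    (hgh : ∀ i : Fin N, g i.rev * h i.rev = (e i)⁻¹)
    (hval : ∀ (k : ℕ) (hk : k < N) (Q' P' : ℂ[X]), Peeled e (initSeg N k) Q P Q' P' →
      Q'.eval (-e ⟨k, hk⟩) = h (Fin.rev ⟨k, hk⟩) * P'.eval (-e ⟨k, hk⟩)) :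
    ∀ n k : ℕ, n + k = N → ∀ Q' P' : ℂ[X], Peeled e (initSeg N k) Q P Q' P' →
      P'.natDegree ≤ n / 2 → Q'.degree < ((n + 1) / 2 : ℕ) → P'.coeff 0 = 1 →
      ∃ q p : ℕ → ℂ[X], q 0 = 0 ∧ p 0 = 1 ∧ q n = Q' ∧ p n = P' ∧
        ∀ j (hj : j < N), j < n → q (j + 1) - q j = C (h ⟨j, hj⟩) * p j ∧
          p (j + 1) - p j = -(X * C (g ⟨j, hj⟩) * q j) := by
  intro n
  induction n with
  | zero =>
    intro k _ Q' P' _ hP' hQ' hP0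
    refine ⟨fun _ => 0, fun _ => 1, rfl, rfl, ?_, ?_, fun j _ hj => absurd hj (Nat.not_lt_zero j)⟩
    · rw [zero_add, show (1 / 2 : ℕ) = 0 from rfl, Nat.cast_zero, ← not_le, zero_le_degree_iff, not_not] at hQ'
      exact hQ'.symm
    · rw [eq_C_of_natDegree_le_zero hP', hP0, C_1]
  | succ n ih =>
    intro k hnk Q₁ P₁ hpeel hP₁ hQ₁ hP0
    have hk : k < N := by omega
    have hnN : n < N := by omega
    set t : Fin N := ⟨k, hk⟩ with ht
    -- From `n + 1 + k = N`: removing the factor of `e t` undoes the step from `n` to `n + 1`.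
    have hrev : Fin.rev t = ⟨n, hnN⟩ := by
      ext
      simp only [ht, Fin.val_rev]
      omega
    have hv := hval k hk Q₁ P₁ hpeel
    have hght := hgh t
    rw [← ht, hrev] at hv
    rw [hrev] at hght
    set g₀ := g ⟨n, hnN⟩
    set h₀ := h ⟨n, hnN⟩
    have het := he0 t
    obtain ⟨Q₂, hQ₂⟩ := exists_mul_of_eval_neg_eq_zero (f := Q₁ - C h₀ * P₁) het
      (by simp [hv])
    obtain ⟨P₂, hP₂⟩ := exists_mul_of_eval_neg_eq_zero (f := P₁ + X * C g₀ * Q₁) het (by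
      simp only [eval_add, eval_mul, eval_X, eval_C, hv]
      have : e t * (g₀ * h₀) = 1 := by rw [hght, mul_inv_cancel₀ het]
      linear_combination (-P₁.eval (-e t)) * this)
    have hQ₁' : Q₁.natDegree ≤ n / 2 := natDegree_le_of_degree_lt hQ₁ (by omega)
    have hpeel' : Peeled e (initSeg N (k + 1)) Q P Q₂ P₂ := by
      rw [initSeg_succ hk]
      exact hpeel.step (notMem_initSeg hk) hQ₂ hP₂
    have hP₂d : P₂.natDegree ≤ n / 2 := by
      rcases eq_or_ne P₂ 0 with h0 | h0
      · simp [h0]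
      have h1 : (P₁ + X * C g₀ * Q₁).natDegree ≤ n / 2 + 1 := by
        refine natDegree_add_le_of_degree_le (hP₁.trans (by omega)) ?_
        rw [add_comm]
        refine natDegree_mul_le_of_le ?_ hQ₁'
        exact (natDegree_mul_C_le _ _).trans natDegree_X_le
      rw [hP₂, natDegree_one_add_C_mul_X_mul (inv_ne_zero het) h0] at h1
      omega
    have hQ₂d : Q₂.degree < ((n + 1) / 2 : ℕ) := by
      rcases eq_or_ne Q₂ 0 with h0 | h0
      · simp [h0]
      have h1 : (Q₁ - C h₀ * P₁).natDegree ≤ (n + 1) / 2 :=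
        (natDegree_sub_le _ _).trans (max_le (hQ₁'.trans (by omega))
          ((natDegree_C_mul_le _ _).trans hP₁))
      rw [hQ₂, natDegree_one_add_C_mul_X_mul (inv_ne_zero het) h0] at h1
      exact (natDegree_lt_iff_degree_lt h0).mp (by omega)
    have hP₂0 : P₂.coeff 0 = 1 := by
      have := congrArg (fun f : ℂ[X] => f.coeff 0) hP₂
      simpa [mul_coeff_zero, hP0] using this.symm
    obtain ⟨q, p, hq0, hp0, hqn, hpn, hstep⟩ :=
      ih (k + 1) (by omega) Q₂ P₂ hpeel' hP₂d hQ₂d hP₂0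
    refine ⟨Function.update q (n + 1) Q₁, Function.update p (n + 1) P₁, ?_, ?_, ?_, ?_, ?_⟩
    · rw [Function.update_of_ne (by omega), hq0]
    · rw [Function.update_of_ne (by omega), hp0]
    · rw [Function.update_self]
    · rw [Function.update_self]
    intro j hj hjn
    rw [Function.update_of_ne (show j ≠ n + 1 by omega),
      Function.update_of_ne (show j ≠ n + 1 by omega)]
    rcases Nat.lt_succ_iff_lt_or_eq.mp hjn with hlt | rfl
    · rw [Function.update_of_ne (by omega), Function.update_of_ne (by omega)]
      exact hstep j hj hlt
    · rw [Function.update_self, Function.update_self, hqn, hpn]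
      have hC : C (e t)⁻¹ = C g₀ * C h₀ := by rw [← C_mul, hght]
      -- The recursion is recovered by inverting the peeling relations, that is, after cancelling
      -- the determinant `1 + X / e t`.
      have hne := one_add_C_mul_X_ne_zero (e t)⁻¹
      constructor
      · refine mul_left_cancel₀ hne ?_
        rw [hC] at hQ₂ hP₂ ⊢
        linear_combination hQ₂ + C h₀ * hP₂
      · refine mul_left_cancel₀ hne ?_
        rw [hC] at hQ₂ hP₂ ⊢
        linear_combination hP₂ - X * C g₀ * hQ₂

/-! ### Properties of an arbitrary solution of the initial value problem. -/

lemma SolvesIVP.peeled {N : ℕ} {e g h : Fin N → ℂ} {q p : Fin (N + 1) → ℂ[X]}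
    (hs : SolvesIVP g h q p) (hgh : ∀ i : Fin N, g i.rev * h i.rev = (e i)⁻¹) :
    ∀ k (_ : k ≤ N), Peeled e (initSeg N k) (q (Fin.last N)) (p (Fin.last N))
      (q ⟨N - k, by omega⟩) (p ⟨N - k, by omega⟩) := by
  intro k
  induction k with
  | zero =>
    intro _
    rw [initSeg_zero]
    exact peeled_empty e _ _
  | succ k ih =>
    intro hk
    set j : Fin N := Fin.rev ⟨k, hk⟩ with hj
    have h1 : j.succ = ⟨N - k, by omega⟩ := by
      ext; simp [hj]; omega
    have h2 : j.castSucc = ⟨N - (k + 1), by omega⟩ := by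
      ext; simp [hj]
    have hq := hs.q_step j
    have hp := hs.p_step j
    have hC : C (e ⟨k, hk⟩)⁻¹ = C (g j) * C (h j) := by rw [← C_mul, ← hgh]
    rw [initSeg_succ hk, ← h2]
    have ih := ih (by omega)
    rw [← h1] at ih
    refine ih.step (g := g j) (h := h j) (notMem_initSeg hk) ?_ ?_
    · rw [hC]
      linear_combination hq - C (h j) * hp
    · rw [hC]
      linear_combination hp + X * C (g j) * hq

/-- The step matrix is singular at this point, with image spanned by `(h, 1)`. -/
lemma SolvesIVP.eval_at_neg {N : ℕ} {e g h : Fin N → ℂ} {q p : Fin (N + 1) → ℂ[X]}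
    (hs : SolvesIVP g h q p) (he0 : ∀ i, e i ≠ 0)
    (hgh : ∀ i : Fin N, g i.rev * h i.rev = (e i)⁻¹) {k : ℕ} (hk : k < N) :
    (q ⟨N - k, by omega⟩).eval (-e ⟨k, hk⟩) =
      h (Fin.rev ⟨k, hk⟩) * (p ⟨N - k, by omega⟩).eval (-e ⟨k, hk⟩) := by
  set j : Fin N := Fin.rev ⟨k, hk⟩ with hj
  have h1 : j.succ = ⟨N - k, by omega⟩ := by
    ext; simp [hj]; omega
  have hq := congrArg (eval (-e ⟨k, hk⟩)) (hs.q_step j)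
  have hp := congrArg (eval (-e ⟨k, hk⟩)) (hs.p_step j)
  have h2 : e ⟨k, hk⟩ * (g j * h j) = 1 := by
    rw [hgh ⟨k, hk⟩, mul_inv_cancel₀ (he0 _)]
  rw [← h1]
  simp only [eval_sub, eval_mul, eval_neg, eval_X, eval_C] at hq hp
  linear_combination hq - h j * hp - (q j.castSucc).eval (-e ⟨k, hk⟩) * h2

lemma SolvesIVP.eval_at_zero {N : ℕ} {g h : Fin N → ℂ} {q p : Fin (N + 1) → ℂ[X]}
    (hs : SolvesIVP g h q p) (k : Fin (N + 1)) : (p k).eval 0 = 1 := by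
  induction k using Fin.induction with
  | zero => simp [hs.p_zero]
  | succ k ih =>
    have := congrArg (eval 0) (hs.p_step k)
    simp only [eval_sub, eval_neg, eval_mul, eval_X, zero_mul, neg_zero] at this
    rw [sub_eq_zero.mp this, ih]

lemma SolvesIVP.degree_le {N : ℕ} {g h : Fin N → ℂ} {q p : Fin (N + 1) → ℂ[X]}
    (hs : SolvesIVP g h q p) (k : Fin (N + 1)) :
    (p k).natDegree ≤ k / 2 ∧ (q k).degree < ((k + 1) / 2 : ℕ) := by
  induction k using Fin.induction with
  | zero => simp [hs.p_zero, hs.q_zero]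
  | succ k ih =>
    obtain ⟨hp, hq⟩ := ih
    rw [Fin.val_castSucc] at hp hq
    rw [Fin.val_succ, ← sub_add_cancel (p k.succ) (p k.castSucc),
      ← sub_add_cancel (q k.succ) (q k.castSucc), hs.q_step, hs.p_step]
    constructor
    · refine natDegree_add_le_of_degree_le ?_ (hp.trans (by omega))
      rw [natDegree_neg]
      rcases eq_or_ne (q k.castSucc) 0 with h0 | h0
      · simp [h0]
      · have h1 := (natDegree_lt_iff_degree_lt h0).mpr hq
        refine (natDegree_mul_le_of_le (m := 1) ((natDegree_mul_C_le _ _).trans natDegree_X_le)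
          le_rfl).trans ?_
        omega
    · exact (degree_add_le _ _).trans_lt (max_lt
        (degree_lt_of_natDegree_le ((natDegree_C_mul_le _ _).trans hp) (by omega))
        (hq.trans_le (by exact_mod_cast (by omega))))

/-! ### `W` as a quotient of polynomials. -/

/-- The numerator of `W` over the common denominator `∏ (ζ_j - X)`. -/
noncomputable def weylNum {K : ℕ} (c : ℂ) (b ζ : Fin K → ℂ) : ℂ[X] :=
  C c * revNodal ζ Finset.univ + ∑ s, C (b s) * revNodal ζ (Finset.univ.erase s)

lemma revNodal_ne_zero {n : ℕ} (ζ : Fin n → ℂ) (J : Finset (Fin n)) : revNodal ζ J ≠ 0 := by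
  intro h
  have := coeff_card_revNodal ζ J
  rw [h, coeff_zero] at this
  exact pow_ne_zero _ (by simp) this.symm

lemma weyl_eq_div {K : ℕ} (c : ℂ) (b ζ : Fin K → ℂ) :
    weyl c b ζ = algebraMap ℂ[X] (RatFunc ℂ) (weylNum c b ζ) /
      algebraMap ℂ[X] (RatFunc ℂ) (revNodal ζ Finset.univ) := by
  have h0 : algebraMap ℂ[X] (RatFunc ℂ) (revNodal ζ Finset.univ) ≠ 0 :=
    (map_ne_zero_iff _ (RatFunc.algebraMap_injective ℂ)).mpr (revNodal_ne_zero _ _)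
  rw [weylNum, map_add, map_mul, map_sum, add_div, mul_div_cancel_right₀ _ h0, weyl,
    RatFunc.algebraMap_C, Finset.sum_div]
  congr 1
  refine Finset.sum_congr rfl fun s _ => ?_
  have h1 : revNodal ζ Finset.univ = (C (ζ s) - X) * revNodal ζ (Finset.univ.erase s) :=
    (Finset.mul_prod_erase _ _ (Finset.mem_univ s)).symm
  rw [h1, map_mul, map_mul, map_sub, RatFunc.algebraMap_C, RatFunc.algebraMap_C,
    RatFunc.algebraMap_X]
  refine (mul_div_mul_right _ _ ?_).symm
  exact (map_ne_zero_iff _ (RatFunc.algebraMap_injective ℂ)).mpr (revNodal_ne_zero _ _)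

lemma eval_weylNum {K : ℕ} (c : ℂ) (b : Fin K → ℂ) {ζ : Fin K → ℂ} {z : ℂ}
    (hz : ∀ s, ζ s - z ≠ 0) :
    (weylNum c b ζ).eval z = weylEval c b ζ z * (revNodal ζ Finset.univ).eval z := by
  rw [weylNum, eval_add, eval_mul, eval_C, eval_finsetSum, weylEval, add_mul, Finset.sum_mul]
  congr 1
  refine Finset.sum_congr rfl fun s _ => ?_
  have h1 : revNodal ζ Finset.univ = (C (ζ s) - X) * revNodal ζ (Finset.univ.erase s) :=
    (Finset.mul_prod_erase _ _ (Finset.mem_univ s)).symm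
  have h2 := hz s
  rw [h1]
  simp only [eval_mul, eval_sub, eval_C, eval_X]
  field_simp

lemma eval_weylNum_node {K : ℕ} (c : ℂ) (b ζ : Fin K → ℂ) (s : Fin K) :
    (weylNum c b ζ).eval (ζ s) = b s * (revNodal ζ (Finset.univ.erase s)).eval (ζ s) := by
  rw [weylNum, eval_add, eval_mul, eval_revNodal,
    Finset.prod_eq_zero (Finset.mem_univ s) (sub_self _), mul_zero, zero_add, eval_finsetSum,
    Finset.sum_eq_single s]
  · rw [eval_mul, eval_C]
  · intro t _ hts
    rw [eval_mul, eval_revNodal (J := Finset.univ.erase t),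
      Finset.prod_eq_zero (Finset.mem_erase.mpr ⟨hts.symm, Finset.mem_univ s⟩) (sub_self _),
      mul_zero]
  · exact fun h => absurd (Finset.mem_univ s) h

/-- A representation of `W` with denominator of degree at most `K` is in lowest terms. -/
lemma eval_of_div_eq_weyl {K : ℕ} {c : ℂ} {b ζ : Fin K → ℂ} (hζ : Function.Injective ζ)
    (hb : ∀ s, b s ≠ 0) {Q P : ℂ[X]} (hP0 : P ≠ 0) (hPd : P.natDegree ≤ K)
    (h : algebraMap ℂ[X] (RatFunc ℂ) Q / algebraMap ℂ[X] (RatFunc ℂ) P = weyl c b ζ) {z : ℂ}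
    (hz : ∀ s, ζ s - z ≠ 0) : P.eval z ≠ 0 ∧ Q.eval z = weylEval c b ζ z * P.eval z := by
  have hinj := RatFunc.algebraMap_injective ℂ
  rw [weyl_eq_div, div_eq_div_iff ((map_ne_zero_iff _ hinj).mpr hP0)
    ((map_ne_zero_iff _ hinj).mpr (revNodal_ne_zero _ _)), ← map_mul, ← map_mul] at h
  have h := hinj h
  -- As `b s ≠ 0`, every `ζ s` is a genuine pole of `W`, hence a root of `P`. The degree bound
  -- leaves no room for another root at `z`.
  have hroot : ∀ s, P.eval (ζ s) = 0 := fun s => by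
    have h1 := congrArg (eval (ζ s)) h
    rw [eval_mul, eval_mul, eval_weylNum_node, eval_revNodal,
      Finset.prod_eq_zero (Finset.mem_univ s) (sub_self _), mul_zero] at h1
    refine (mul_eq_zero.mp h1.symm).resolve_left (mul_ne_zero (hb s) ?_)
    rw [eval_revNodal]
    exact Finset.prod_ne_zero_iff.mpr fun j hj =>
      sub_ne_zero.mpr fun h => (Finset.mem_erase.mp hj).1 (hζ h)
  have hPz : P.eval z ≠ 0 := fun hPz => by
    refine hP0 (eq_zero_of_natDegree_lt_card_of_eval_eq_zero' P
      (insert z (Finset.univ.image ζ)) ?_ ?_)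
    · intro x hx
      rcases Finset.mem_insert.mp hx with rfl | hx
      · exact hPz
      · obtain ⟨s, _, rfl⟩ := Finset.mem_image.mp hx
        exact hroot s
    · rw [Finset.card_insert_of_notMem, Finset.card_image_of_injective _ hζ, Finset.card_univ,
        Fintype.card_fin]
      · omega
      · intro hx
        obtain ⟨s, _, hs⟩ := Finset.mem_image.mp hx
        exact hz s (sub_eq_zero.mpr hs)
  refine ⟨hPz, ?_⟩
  have h2 := congrArg (eval z) h
  have h3 : (revNodal ζ Finset.univ).eval z ≠ 0 := by
    rw [eval_revNodal]
    exact Finset.prod_ne_zero_iff.mpr fun s _ => hz s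
  rw [eval_mul, eval_mul, eval_weylNum c b hz] at h2
  refine mul_right_cancel₀ h3 ?_
  linear_combination h2

/-! ### The formulas for `g` and `h`, and assembly of the theorem. -/

section Solution

variable {N : ℕ} {m : Fin N → ℝ} {c : ℂ} {b ζ : Fin (N / 2) → ℂ}

lemma eVec_ne_zero (hm : ∀ j, 0 < m j) (i : Fin N) : eVec m i ≠ 0 :=
  one_div_ne_zero (pow_ne_zero _ (Complex.ofReal_ne_zero.mpr (hm _).ne'))

lemma eVec_injective (hm : ∀ j, 0 < m j) (hinj : Function.Injective m) :
    Function.Injective (eVec m) := by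
  intro i j h
  rw [eVec, eVec, one_div, one_div, inv_inj] at h
  have h1 : m i.rev ^ 2 = m j.rev ^ 2 := by exact_mod_cast h
  exact Fin.rev_injective (hinj ((pow_left_inj₀ (hm _).le (hm _).le two_ne_zero).mp h1))

lemma eVec_add_ne_zero (hm : ∀ j, 0 < m j) {z : ℂ} (hz : ∀ t : ℝ, t < 0 → z ≠ (t : ℂ))
    (i : Fin N) : eVec m i + z ≠ 0 := by
  intro h
  refine hz (-(1 / m i.rev ^ 2)) (neg_neg_of_pos (by have := hm i.rev; positivity)) ?_
  rw [eVec] at h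
  push_cast
  linear_combination h

lemma D_zero {K : ℕ} (e : Fin N → ℂ) (c : ℂ) (b ζ : Fin K → ℂ) {p : ℕ} (hp : p ≤ 1) :
    D e c b ζ 0 0 p = 1 := by
  rw [D_eq_vdm_mul e c b ζ (u := fun s => b s * ζ s ^ p / ∏ i ∈ initSeg N 0, (e i + ζ s))
    (by omega) fun s => rfl, subsetSum_zero, subsetSumPred_zero, initSeg_zero]
  simp [vdm]

/-- The only index set of full size is the whole one, so this `D` is a single product with every `b
s * ζ s` as a factor. -/
lemma forall_ne_zero_of_D_ne_zero {e : Fin N → ℂ} (hc : Even N → c = 0)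
    (h : D e c b ζ N (N / 2) 1 ≠ 0) (s : Fin (N / 2)) : b s ≠ 0 ∧ ζ s ≠ 0 := by
  rw [D_eq_vdm_mul e c b ζ (u := fun s => b s * ζ s ^ 1 / ∏ i ∈ initSeg N N, (e i + ζ s))
    (by omega) fun s => rfl] at h
  have h0 : (if 1 + 2 * (N / 2) = N + 1 then c else 0) = 0 := by
    split_ifs with h1
    · exact hc ⟨N / 2, by omega⟩
    · rfl
  have h1 : Finset.univ.filter (fun J : Finset (Fin (N / 2)) => J.card = N / 2) =
      {Finset.univ} := by
    ext J
    rw [Finset.mem_filter, Finset.mem_singleton, ← Finset.card_eq_iff_eq_univ, Fintype.card_fin]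
    simp
  rw [h0, zero_mul, add_zero, subsetSum, h1, Finset.sum_singleton] at h
  have h2 := Finset.prod_ne_zero_iff.mp (right_ne_zero_of_mul (right_ne_zero_of_mul h)) s
    (Finset.mem_univ s)
  have h3 := left_ne_zero_of_mul (div_ne_zero_iff.mp h2).1
  exact ⟨h3, by simpa using right_ne_zero_of_mul (div_ne_zero_iff.mp h2).1⟩

lemma prodOver_initSeg_succ {e : Fin N → ℂ} (i : Fin N) :
    prodOver e (initSeg N (i + 1)) = e i * prodOver e (initSeg N i) := by
  rw [initSeg_succ i.isLt, prodOver, Finset.prod_insert (notMem_initSeg i.isLt)]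
  rfl

variable {e : Fin N → ℂ}

/-- The strength `h_{k'}`, `k = i + 1`. -/
noncomputable def hSol {K : ℕ} (e : Fin N → ℂ) (c : ℂ) (b ζ : Fin K → ℂ) (i : Fin N) : ℂ :=
  (prodOver e (initSeg N i) * D e c b ζ (i + 1) ((i + 2) / 2) 0 *
    D e c b ζ i ((i + 1) / 2) 0) / (D e c b ζ (i + 1) ((i + 1) / 2) 1 * D e c b ζ i (i / 2) 1)

/-- The strength `g_{k'}`, `k = i + 1`. -/
noncomputable def gSol {K : ℕ} (e : Fin N → ℂ) (c : ℂ) (b ζ : Fin K → ℂ) (i : Fin N) : ℂ :=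
  (D e c b ζ (i + 1) ((i + 1) / 2) 1 * D e c b ζ i (i / 2) 1) /
    (prodOver e (initSeg N (i + 1)) * D e c b ζ (i + 1) ((i + 2) / 2) 0 *
      D e c b ζ i ((i + 1) / 2) 0)

lemma prodOver_ne_zero (he0 : ∀ i, e i ≠ 0) (J : Finset (Fin N)) : prodOver e J ≠ 0 :=
  Finset.prod_ne_zero_iff.mpr fun i _ => he0 i

lemma hSol_ne_zero (he0 : ∀ i, e i ≠ 0)
    (hA : ∀ k ≤ N, D e c b ζ k ((k + 1) / 2) 0 ≠ 0) (hB : ∀ k ≤ N, D e c b ζ k (k / 2) 1 ≠ 0)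
    (i : Fin N) : hSol e c b ζ i ≠ 0 :=
  div_ne_zero (mul_ne_zero (mul_ne_zero (prodOver_ne_zero he0 _) (hA (i + 1) i.isLt))
    (hA i i.isLt.le)) (mul_ne_zero (hB (i + 1) i.isLt) (hB i i.isLt.le))

lemma gSol_mul_hSol (he0 : ∀ i, e i ≠ 0)
    (hA : ∀ k ≤ N, D e c b ζ k ((k + 1) / 2) 0 ≠ 0) (hB : ∀ k ≤ N, D e c b ζ k (k / 2) 1 ≠ 0)
    (i : Fin N) : gSol e c b ζ i * hSol e c b ζ i = (e i)⁻¹ := by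
  have h1 := hA (i + 1) i.isLt
  have h2 := hA i i.isLt.le
  have h3 := hB (i + 1) i.isLt
  have h4 := hB i i.isLt.le
  have h5 := prodOver_ne_zero he0 (initSeg N i)
  have h6 := he0 i
  rw [gSol, hSol, prodOver_initSeg_succ]
  rw [show (i : ℕ) + 1 + 1 = i + 2 from rfl] at h1
  field_simp

lemma SolvesIVP.eq_solution {g h : Fin N → ℂ} {q p : Fin (N + 1) → ℂ[X]}
    (he : Function.Injective e) (he0 : ∀ i, e i ≠ 0) (hζ : Function.Injective ζ)
    (heζ : ∀ i s, e i + ζ s ≠ 0) (hb : ∀ s, b s ≠ 0)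
    (hA : ∀ k ≤ N, D e c b ζ k ((k + 1) / 2) 0 ≠ 0) (hB : ∀ k ≤ N, D e c b ζ k (k / 2) 1 ≠ 0)
    (hgh : ∀ i : Fin N, g i.rev * h i.rev = (e i)⁻¹) (hs : SolvesIVP g h q p)
    (hW : algebraMap ℂ[X] (RatFunc ℂ) (q (Fin.last N)) /
      algebraMap ℂ[X] (RatFunc ℂ) (p (Fin.last N)) = weyl c b ζ) (i : Fin N) :
    g i.rev = gSol e c b ζ i ∧ h i.rev = hSol e c b ζ i := by
  have hp0 : p (Fin.last N) ≠ 0 := fun h0 => by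
    have := hs.eval_at_zero (Fin.last N)
    simp [h0] at this
  have hW' := fun j => eval_of_div_eq_weyl hζ hb hp0 (hs.degree_le (Fin.last N)).1 hW
    (z := -e j) fun s => by rw [sub_neg_eq_add, add_comm]; exact heζ j s
  obtain ⟨h1, h2⟩ := (hs.peeled hgh i i.isLt.le).eval_at_neg he he0 hζ heζ i.isLt
    (fun j => (hW' j).1) (fun j => (hW' j).2) (hB i i.isLt.le) (hB (i + 1) i.isLt)
  have hh : h i.rev = hSol e c b ζ i :=
    mul_right_cancel₀ h1 ((hs.eval_at_neg he0 hgh i.isLt).symm.trans h2)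
  -- Both candidates for `g` have the same product with the nonzero `h`.
  refine ⟨mul_right_cancel₀ (hSol_ne_zero he0 hA hB i) ?_, hh⟩
  rw [gSol_mul_hSol he0 hA hB, ← hgh, hh]

lemma natDegree_weylNum_le {K : ℕ} (c : ℂ) (b ζ : Fin K → ℂ) : (weylNum c b ζ).natDegree ≤ K := by
  have h : ∀ J : Finset (Fin K), (revNodal ζ J).natDegree ≤ K := fun J =>
    (natDegree_revNodal_le ζ J).trans (by simpa using J.card_le_univ)
  refine natDegree_add_le_of_degree_le ((natDegree_C_mul_le _ _).trans (h _)) ?_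
  exact natDegree_sum_le_of_forall_le _ _ fun s _ => (natDegree_C_mul_le _ _).trans (h _)

lemma degree_weylNum_lt {K : ℕ} (b ζ : Fin K → ℂ) : (weylNum 0 b ζ).degree < K := by
  rw [weylNum, C_0, zero_mul, zero_add]
  refine (degree_sum_le _ _).trans_lt ((Finset.sup_lt_iff (WithBot.bot_lt_coe K)).mpr ?_)
  intro s _
  refine degree_lt_of_natDegree_le ((natDegree_C_mul_le _ _).trans (natDegree_revNodal_le ζ _)) ?_
  rw [Finset.card_erase_of_mem (Finset.mem_univ s), Finset.card_univ, Fintype.card_fin]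
  exact Nat.sub_lt s.pos one_pos

lemma exists_solvesIVP (he : Function.Injective e) (he0 : ∀ i, e i ≠ 0)
    (hζ : Function.Injective ζ) (heζ : ∀ i s, e i + ζ s ≠ 0) (hζ0 : ∀ s, ζ s ≠ 0)
    (hc : Even N → c = 0) (hA : ∀ k ≤ N, D e c b ζ k ((k + 1) / 2) 0 ≠ 0)
    (hB : ∀ k ≤ N, D e c b ζ k (k / 2) 1 ≠ 0) :
    ∃ q p : Fin (N + 1) → ℂ[X],
      SolvesIVP (fun j => gSol e c b ζ j.rev) (fun j => hSol e c b ζ j.rev) q p ∧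
      algebraMap ℂ[X] (RatFunc ℂ) (q (Fin.last N)) /
        algebraMap ℂ[X] (RatFunc ℂ) (p (Fin.last N)) = weyl c b ζ := by
  -- Scaling numerator and denominator by `κ` normalises `P(0) = 1`, as the recursion requires.
  set κ := ((revNodal ζ Finset.univ).eval 0)⁻¹ with hκ
  have hr0 : (revNodal ζ Finset.univ).eval 0 ≠ 0 := by
    rw [eval_revNodal]
    exact Finset.prod_ne_zero_iff.mpr fun s _ => by simpa using hζ0 s
  have hκ0 : κ ≠ 0 := inv_ne_zero hr0
  have hez : ∀ i s, ζ s - -e i ≠ 0 := fun i s => by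
    rw [sub_neg_eq_add, add_comm]; exact heζ i s
  have hPd : (C κ * revNodal ζ Finset.univ).natDegree ≤ N / 2 :=
    (natDegree_C_mul_le _ _).trans ((natDegree_revNodal_le ζ _).trans (by simp))
  have hQd : (C κ * weylNum c b ζ).degree < ((N + 1) / 2 : ℕ) := by
    rw [degree_C_mul hκ0]
    -- For even `N` the strict degree bound needs `c = 0`; for odd `N` there is room for the
    -- constant term of `W`.
    rcases Nat.even_or_odd N with hN | hN
    · rw [hc hN]
      refine (degree_weylNum_lt b ζ).trans_le ?_
      exact_mod_cast (by omega)
    · obtain ⟨r, hr⟩ := hN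
      exact degree_lt_of_natDegree_le (natDegree_weylNum_le c b ζ) (by omega)
  have hP0 : (C κ * revNodal ζ Finset.univ).coeff 0 = 1 := by
    rw [coeff_zero_eq_eval_zero, eval_mul, eval_C, hκ, inv_mul_cancel₀ hr0]
  obtain ⟨q, p, hq0, hp0, hqN, hpN, hstep⟩ := exists_chain (e := e)
    (g := fun j => gSol e c b ζ j.rev) (h := fun j => hSol e c b ζ j.rev)
    (Q := C κ * weylNum c b ζ) (P := C κ * revNodal ζ Finset.univ) he0
    (fun i => by simp only [Fin.rev_rev]; exact gSol_mul_hSol he0 hA hB i)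
    (fun k hk Q' P' hpeel => by
      rw [Fin.rev_rev]
      refine (hpeel.eval_at_neg he he0 hζ heζ hk (fun i => ?_) (fun i => ?_) (hB k hk.le)
        (hB (k + 1) hk)).2
      · rw [eval_mul, eval_C, eval_revNodal]
        exact mul_ne_zero hκ0 (Finset.prod_ne_zero_iff.mpr fun s _ => hez i s)
      · rw [eval_mul, eval_mul, eval_weylNum c b (hez i)]
        ring)
    N 0 (Nat.add_zero N) (C κ * weylNum c b ζ) (C κ * revNodal ζ Finset.univ)
    (by rw [initSeg_zero]; exact peeled_empty e _ _) hPd hQd hP0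
  refine ⟨fun k => q k, fun k => p k, ⟨hq0, hp0, fun k => ?_, fun k => ?_⟩, ?_⟩
  · exact (hstep k k.isLt k.isLt).1
  · exact (hstep k k.isLt k.isLt).2
  · have hinj := RatFunc.algebraMap_injective ℂ
    simp only [Fin.val_last, hqN, hpN]
    rw [map_mul, map_mul, weyl_eq_div]
    exact mul_div_mul_left _ _ ((map_ne_zero_iff _ hinj).mpr (C_ne_zero.mpr hκ0))

end Solution

end PeakonInverse

open PeakonInverse in
theorem mainTheorem4 (N : ℕ) (m : Fin N → ℝ) (c : ℂ) (b ζ : Fin (N / 2) → ℂ)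
    (hm_pos : ∀ j, 0 < m j) (hm_inj : Function.Injective m)
    (hζ_inj : Function.Injective ζ)
    (hζ_neg : ∀ j, ∀ t : ℝ, t < 0 → ζ j ≠ (t : ℂ))
    (hc : Even N → c = 0)
    (hD_odd : ∀ k : ℕ, 1 ≤ k → k ≤ N → Odd k →
      PeakonInverse.D (PeakonInverse.eVec m) c b ζ k ((k + 1) / 2) 0 ≠ 0 ∧
      PeakonInverse.D (PeakonInverse.eVec m) c b ζ k ((k - 1) / 2) 1 ≠ 0)
    (hD_even : ∀ k : ℕ, 1 ≤ k → k ≤ N → Even k →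
      PeakonInverse.D (PeakonInverse.eVec m) c b ζ k (k / 2) 0 ≠ 0 ∧
      PeakonInverse.D (PeakonInverse.eVec m) c b ζ k (k / 2) 1 ≠ 0) :
    (∃! gh : (Fin N → ℂ) × (Fin N → ℂ),
      PeakonInverse.SolvesInverseProblem (PeakonInverse.weyl c b ζ) m gh.1 gh.2) ∧
    ∀ g h : Fin N → ℂ,
      PeakonInverse.SolvesInverseProblem (PeakonInverse.weyl c b ζ) m g h →
      -- `i` is the position of the index `k = i + 1`, and `i.rev` that of `k' = N - k + 1`
      ∀ (i : Fin N) (k : ℕ), k = i.val + 1 →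
        let D := PeakonInverse.D (PeakonInverse.eVec m) c b ζ
        let E := fun r : ℕ => PeakonInverse.prodOver (PeakonInverse.eVec m)
          (PeakonInverse.initSeg N r)
        (Odd k →
          g i.rev = (D k ((k - 1) / 2) 1 * D (k - 1) ((k - 1) / 2) 1) /
            (E k * D k ((k + 1) / 2) 0 * D (k - 1) ((k - 1) / 2) 0) ∧
          h i.rev = (E (k - 1) * D k ((k + 1) / 2) 0 * D (k - 1) ((k - 1) / 2) 0) /
            (D k ((k - 1) / 2) 1 * D (k - 1) ((k - 1) / 2) 1)) ∧
        (Even k →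
          g i.rev = (D k (k / 2) 1 * D (k - 1) (k / 2 - 1) 1) /
            (E k * D k (k / 2) 0 * D (k - 1) (k / 2) 0) ∧
          h i.rev = (E (k - 1) * D k (k / 2) 0 * D (k - 1) (k / 2) 0) /
            (D k (k / 2) 1 * D (k - 1) (k / 2 - 1) 1)) := by
  set e := eVec m with he_def
  have he : Function.Injective e := eVec_injective hm_pos hm_inj
  have he0 : ∀ i, e i ≠ 0 := eVec_ne_zero hm_pos
  have heζ : ∀ i s, e i + ζ s ≠ 0 := fun i s => eVec_add_ne_zero hm_pos (hζ_neg s) i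
  have hm_inv : ∀ i : Fin N, (m i.rev : ℂ) ^ 2 = (e i)⁻¹ := fun i => by
    rw [he_def, eVec, one_div, inv_inv]
  have hA : ∀ k ≤ N, D e c b ζ k ((k + 1) / 2) 0 ≠ 0 := fun k hk => by
    rcases Nat.eq_zero_or_pos k with rfl | hpos
    · rw [D_zero e c b ζ zero_le_one]
      exact one_ne_zero
    rcases Nat.even_or_odd k with hev | hod
    · have h := (hD_even k hpos hk hev).1
      rwa [show k / 2 = (k + 1) / 2 by obtain ⟨r, hr⟩ := hev; omega] at h
    · exact (hD_odd k hpos hk hod).1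
  have hB : ∀ k ≤ N, D e c b ζ k (k / 2) 1 ≠ 0 := fun k hk => by
    rcases Nat.eq_zero_or_pos k with rfl | hpos
    · rw [D_zero e c b ζ le_rfl]
      exact one_ne_zero
    rcases Nat.even_or_odd k with hev | hod
    · exact (hD_even k hpos hk hev).2
    · have h := (hD_odd k hpos hk hod).2
      rwa [show (k - 1) / 2 = k / 2 by obtain ⟨r, hr⟩ := hod; omega] at h
  have hbζ := forall_ne_zero_of_D_ne_zero hc (hB N le_rfl)
  have huniq : ∀ g h : Fin N → ℂ, SolvesInverseProblem (weyl c b ζ) m g h → ∀ i : Fin N,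
      g i.rev = gSol e c b ζ i ∧ h i.rev = hSol e c b ζ i := by
    rintro g h ⟨hgh, q, p, hs, hW⟩ i
    exact hs.eq_solution he he0 hζ_inj heζ (fun s => (hbζ s).1) hA hB
      (fun i => by rw [hgh, hm_inv]) hW i
  refine ⟨⟨(fun j => gSol e c b ζ j.rev, fun j => hSol e c b ζ j.rev), ⟨fun j => ?_, ?_⟩, ?_⟩, ?_⟩
  · have h := gSol_mul_hSol he0 hA hB j.rev
    rw [← hm_inv, Fin.rev_rev] at h
    exact h
  · exact exists_solvesIVP he he0 hζ_inj heζ (fun s => (hbζ s).2) hc hA hB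
  · rintro ⟨g, h⟩ hgh
    refine Prod.ext (funext fun j => ?_) (funext fun j => ?_)
    · have h1 := (huniq g h hgh j.rev).1
      rwa [Fin.rev_rev] at h1
    · have h1 := (huniq g h hgh j.rev).2
      rwa [Fin.rev_rev] at h1
  · rintro g h hgh i k rfl
    obtain ⟨h1, h2⟩ := huniq g h hgh i
    rw [h1, h2, gSol, hSol]
    simp only [Nat.add_sub_cancel]
    constructor
    · rintro ⟨r, hr⟩
      have hi : (i : ℕ) = 2 * r := by omega
      rw [hi, show (2 * r + 1) / 2 = r by omega, show 2 * r / 2 = r by omega,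
        show (2 * r + 2) / 2 = r + 1 by omega]
      exact ⟨rfl, rfl⟩
    · rintro ⟨r, hr⟩
      have hi : (i : ℕ) + 1 = r + r := by omega
      rw [show ((i : ℕ) + 1) / 2 = r by omega, show (i : ℕ) / 2 = r - 1 by omega,
        show ((i : ℕ) + 2) / 2 = r by omega]
      exact ⟨rfl, rfl⟩
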